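/- **Conventions.** A *ZX diagram* $m\to n$ is a finite undirected multigraph whose vertices are $m$ inputs and $n$ outputs (each totally ordered, all of degree one), $Z$ and $X$ vertices ("spiders") labelled by an angle $\alpha\in\mathbb{R}/2\pi\mathbb{Z}$, and $H$ vertices of degree two. It is *circuit-like* if (C1) all of its vertices can be covered by a set $\mathcal P$ of disjoint directed paths, each of which ends in an output; (C2) every oriented cycle that contains at least two edges from different paths of $\mathcal P$ traverses at least one path edge in the direction opposite to that of its path; (C3) it is a simple graph and is 3-coloured, i.e. no two adjacent interior vertices have the same type $Z$, $X$ or $H$. A *pattern* $\mathfrak P$ of the measurement calculus on a finite set of qubits is a sequence of commands $N_i$ (initialise), $E_{ij}$ with $i\ne j$ (entangle), ${}^s[M_i^\alpha]^t$ (measure), and (possibly conditional) Pauli corrections $X_i^s$, $Z_i^s$, such that initialisation is the first and measurement the last command acting on a qubit, and no command depends on a measurement not yet performed. Its *geometry* $G(\mathfrak P)=((V,E),I,O)$ has the qubits as vertices, the non-initialised qubits as inputs $I$, the non-measured qubits as outputs $O$, and $u\sim v$ iff $E_{uv}$ (or $E_{vu}$) occurs in $\mathfrak P$. A *flow* on $((V,E),I,O)$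 is a pair $(f,\prec)$ of a function $f:V\setminus O\to V\setminus I$ and a partial order $\prec$ on $V$ such that $f(u)\sim u$; $u\prec f(u)$; and if $f(u)\sim v$ and $u\ne v$, then $u\prec v$. The diagram $D(\Gamma):|I|\to|O|$ of an open graph $\Gamma=((V,E),I,O)$ has the vertex set $V+E+I+O$, where the vertices from $V$ are $Z$ vertices with angle $0$, those from $E$ are $H$ vertices, those from $I$ and $O$ are the inputs and outputs; each $e=uv\in E$ is joined to $u$ and to $v$, and each input or output vertex is joined to the corresponding vertex from $V$. **Theorem.** Let $\mathfrak P$ be a pattern. If its geometry $G(\mathfrak P)$ has a flow, then $D(G(\mathfrak P))$ is equivalent to a circuit-like diagram. The equivalence uses only isomorphism of labelled graphs and the following rules of the ZX-calculus, each for both colours and in both directions: the spider rule (adjacent spiders of the same colour fuse and their angles add, a loop at a spider may be removed, and a spider of degree two with angle $0$ is a plain wire), the colour change rule (a spider equals the spider of the other colour with the same angle and an $H$ vertex on each leg), and $H$-cancellation (two consecutive $H$ vertices cancel). -/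

import Mathlib

namespace ZX

/-! ### Diagrams -/

/-- The two observables: `Z` (green) and `X` (red). -/
inductive Colour
  | Z
  | X

/-- Exchange of the two colours. -/
def Colour.swap : Colour → Colour
  | .Z => .X
  | .X => .Z

/-- The types of vertices of a diagram with `m` inputs and `n` outputs.  The phase of a spider is an
angle modulo `2π`. -/
inductive Kind (m n : ℕ)
  | input (i : Fin m)
  | output (j : Fin n)
  | spider (c : Colour) (α : Real.Angle)
  | hadamard

/-- Input or output vertex. -/
def Kind.IsBoundary {m n : ℕ} : Kind m n → Prop
  | .input _ => True
  | .output _ => True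
  | _ => False

/-- Two interior vertices have the same type (`Z`, `X` or `H`), regardless of phases. -/
def Kind.SameType {m n : ℕ} : Kind m n → Kind m n → Prop
  | .spider c _, .spider c' _ => c = c'
  | .hadamard, .hadamard => True
  | _, _ => False

/-- The degree of a vertex of a finite undirected multigraph; a loop counts twice. -/
noncomputable def degree {V E : Type} (ends : E → Sym2 V) (v : V) : ℕ :=
  {e | v ∈ ends e}.ncard + {e | ends e = s(v, v)}.ncard

/-- A (ZX-calculus) diagram `m → n`: a finite undirected multigraph (parallel edges and loops are
allowed) with typed vertices.  There is exactly one `i`-th input and exactly one `j`-th output; the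
boundary vertices have degree one, and the Hadamard vertices have degree two. -/
structure Diagram (m n : ℕ) where
  V : Type
  E : Type
  finite_V : Finite V
  finite_E : Finite E
  ends : E → Sym2 V
  kind : V → Kind m n
  existsUnique_input : ∀ i, ∃! v, kind v = .input i
  existsUnique_output : ∀ j, ∃! v, kind v = .output j
  degree_boundary : ∀ v, (kind v).IsBoundary → degree ends v = 1
  degree_hadamard : ∀ v, kind v = .hadamard → degree ends v = 2

namespace Diagram

variable {m n : ℕ}

/-! ### Rewriting

Every rule is given as a relation between a diagram `D` and a larger diagram `D'`, in which `D'` is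
identified, through bijections `φ` of vertices and `ψ` of edges, with the result of an explicit
modification of `D`.  The equational theory is generated by reading the rules in both directions. -/

/-- Isomorphism of labelled graphs. -/
def Iso (D D' : Diagram m n) : Prop :=
  ∃ (φ : D.V ≃ D'.V) (ψ : D.E ≃ D'.E),
    (∀ v, D'.kind (φ v) = D.kind v) ∧
    (∀ e, D'.ends (ψ e) = (D.ends e).map φ)

/-- The spider rule: contracting an edge between two distinct spiders of the same colour in `D'`, and
adding their phases, gives `D`.  The two spiders of `D'` are `φ (some a)` and `φ none`, the contracted
edge is `ψ none`; every other edge is kept, with `φ none` replaced by `a`. -/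
def SpiderRule (D D' : Diagram m n) : Prop :=
  ∃ (c : Colour) (α β : Real.Angle) (a : D.V) (φ : Option D.V ≃ D'.V) (ψ : Option D.E ≃ D'.E),
    D.kind a = .spider c (α + β) ∧
    D'.kind (φ (some a)) = .spider c α ∧
    D'.kind (φ none) = .spider c β ∧
    (∀ v, v ≠ a → D'.kind (φ (some v)) = D.kind v) ∧
    D'.ends (ψ none) = s(φ (some a), φ none) ∧
    (∀ e, (D'.ends (ψ (some e))).map (fun w => (φ.symm w).getD a) = D.ends e)

/-- A loop at a spider may be removed: `D` is `D'` without the loop `ψ none`. -/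
def AntiLoopRule (D D' : Diagram m n) : Prop :=
  ∃ (c : Colour) (α : Real.Angle) (a : D.V) (φ : D.V ≃ D'.V) (ψ : Option D.E ≃ D'.E),
    D.kind a = .spider c α ∧
    (∀ v, D'.kind (φ v) = D.kind v) ∧
    D'.ends (ψ none) = s(φ a, φ a) ∧
    (∀ e, D'.ends (ψ (some e)) = (D.ends e).map φ)

/-- A spider of degree two with phase `0` is a plain wire: `D'` is `D` with the edge `e₀`, joining `x`
and `y`, subdivided by the spider `φ none`. -/
def IdentityRule (D D' : Diagram m n) : Prop :=
  ∃ (c : Colour) (e₀ : D.E) (x y : D.V) (φ : Option D.V ≃ D'.V) (ψ : Option D.E ≃ D'.E),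
    D.ends e₀ = s(x, y) ∧
    (∀ v, D'.kind (φ (some v)) = D.kind v) ∧
    D'.kind (φ none) = .spider c 0 ∧
    D'.ends (ψ (some e₀)) = s(φ (some x), φ none) ∧
    D'.ends (ψ none) = s(φ none, φ (some y)) ∧
    (∀ e, e ≠ e₀ → D'.ends (ψ (some e)) = (D.ends e).map (fun v => φ (some v)))

/-- Two consecutive Hadamard vertices cancel: `D'` is `D` with the edge `e₀`, joining `x` and `y`,
replaced by a path from `x` through two Hadamard vertices to `y`. -/
def HCancelRule (D D' : Diagram m n) : Prop :=
  ∃ (e₀ : D.E) (x y : D.V) (φ : D.V ⊕ Bool ≃ D'.V) (ψ : D.E ⊕ Bool ≃ D'.E),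
    D.ends e₀ = s(x, y) ∧
    (∀ v, D'.kind (φ (.inl v)) = D.kind v) ∧
    (∀ b, D'.kind (φ (.inr b)) = .hadamard) ∧
    D'.ends (ψ (.inl e₀)) = s(φ (.inl x), φ (.inr false)) ∧
    D'.ends (ψ (.inr false)) = s(φ (.inr false), φ (.inr true)) ∧
    D'.ends (ψ (.inr true)) = s(φ (.inr true), φ (.inl y)) ∧
    (∀ e, e ≠ e₀ → D'.ends (ψ (.inl e)) = (D.ends e).map (fun v => φ (.inl v)))

/-- Colour change: a spider `a` (without loops) equals the spider of the other colour with the same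
phase and a Hadamard vertex on each of its legs.  The leg `e` of `a` in `D`, with other end `w`, becomes
the path `a — φ (inr e) — w` in `D'`. -/
def ColourChangeRule (D D' : Diagram m n) : Prop :=
  ∃ (c : Colour) (α : Real.Angle) (a : D.V)
    (φ : D.V ⊕ {e : D.E // a ∈ D.ends e} ≃ D'.V) (ψ : D.E ⊕ {e : D.E // a ∈ D.ends e} ≃ D'.E),
    D.kind a = .spider c α ∧
    (∀ e, D.ends e ≠ s(a, a)) ∧
    D'.kind (φ (.inl a)) = .spider c.swap α ∧
    (∀ v, v ≠ a → D'.kind (φ (.inl v)) = D.kind v) ∧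
    (∀ e, D'.kind (φ (.inr e)) = .hadamard) ∧
    (∀ e, D'.ends (ψ (.inr e)) = s(φ (.inl a), φ (.inr e))) ∧
    (∀ (e : {e : D.E // a ∈ D.ends e}) (w : D.V), D.ends e = s(a, w) →
      D'.ends (ψ (.inl e)) = s(φ (.inr e), φ (.inl w))) ∧
    (∀ e, a ∉ D.ends e → D'.ends (ψ (.inl e)) = (D.ends e).map (fun v => φ (.inl v)))

/-- One application of a rule. -/
inductive Step : Diagram m n → Diagram m n → Prop
  | iso {D D' : Diagram m n} : Iso D D' → Step D D'
  | spider {D D' : Diagram m n} : SpiderRule D D' → Step D D'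
  | antiLoop {D D' : Diagram m n} : AntiLoopRule D D' → Step D D'
  | identity {D D' : Diagram m n} : IdentityRule D D' → Step D D'
  | hCancel {D D' : Diagram m n} : HCancelRule D D' → Step D D'
  | colourChange {D D' : Diagram m n} : ColourChangeRule D D' → Step D D'

/-- Provable equality of diagrams, using only the spider rules (fusion, removal of loops, trivial
spider), colour change and cancellation of Hadamards.  In particular the diagrams are equal in the
ZX-calculus, which has further rules. -/
def Equivalent (D D' : Diagram m n) : Prop :=
  Relation.EqvGen Step D D'

/-! ### Circuit-like diagrams -/

/-- The adjacency relation of a diagram. -/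
def graph (D : Diagram m n) : SimpleGraph D.V where
  Adj u v := u ≠ v ∧ ∃ e, D.ends e = s(u, v)
  symm := ⟨fun _ _ h => ⟨h.1.symm, h.2.imp fun _ he => he.trans Sym2.eq_swap⟩⟩
  loopless := ⟨fun _ h => h.1 rfl⟩

/-- The multigraph has neither loops nor parallel edges. -/
def IsSimple (D : Diagram m n) : Prop :=
  Function.Injective D.ends ∧ ∀ e, ¬ (D.ends e).IsDiag

/-- The types `Z`, `X`, `H` are a colouring of the interior: no two adjacent interior vertices have the
same type. -/
def IsThreeColoured (D : Diagram m n) : Prop :=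
  ∀ u v, D.graph.Adj u v → ¬ (D.kind u).SameType (D.kind v)

/-- A directed path, given by the list of its vertices, that ends in an output. -/
def IsPathToOutput (D : Diagram m n) (p : List D.V) : Prop :=
  p.IsChain D.graph.Adj ∧ p.Nodup ∧ ∃ v j, p.getLast? = some v ∧ D.kind v = .output j

/-- The directed path `p` goes directly from `x` to `y`. -/
def PathStep {V : Type} (p : List V) (x y : V) : Prop :=
  [x, y] <:+: p

/-- A diagram is circuit-like if
(1) all its vertices are covered by a set `Ps` of disjoint directed paths, each ending in an output;
(2) every oriented cycle that contains two edges from different paths of `Ps` traverses some edge of a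
path of `Ps` against the direction of that path;
(3) it is a simple graph, and is 3-coloured. -/
def CircuitLike (D : Diagram m n) : Prop :=
  (∃ Ps : Set (List D.V),
    (∀ p ∈ Ps, D.IsPathToOutput p) ∧
    (∀ p ∈ Ps, ∀ q ∈ Ps, p ≠ q → p.Disjoint q) ∧
    (∀ v, ∃ p ∈ Ps, v ∈ p) ∧
    (∀ (v : D.V) (γ : D.graph.Walk v v), γ.IsCycle →
      (∃ p ∈ Ps, ∃ q ∈ Ps, p ≠ q ∧
        (∃ d ∈ γ.darts, PathStep p d.fst d.snd ∨ PathStep p d.snd d.fst) ∧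
        (∃ d ∈ γ.darts, PathStep q d.fst d.snd ∨ PathStep q d.snd d.fst)) →
      ∃ p ∈ Ps, ∃ d ∈ γ.darts, PathStep p d.snd d.fst)) ∧
  D.IsSimple ∧ D.IsThreeColoured

end Diagram

/-! ### Open graphs and flow -/

/-- An open graph: an undirected graph with input and output vertices. -/
structure OpenGraph (V : Type) where
  graph : SimpleGraph V
  inputs : Finset V
  outputs : Finset V

namespace OpenGraph

variable {V : Type}

/-- A (causal) flow `(f, ≺)` on an open graph. -/
structure Flow (Γ : OpenGraph V) where
  f : {v // v ∉ Γ.outputs} → {v // v ∉ Γ.inputs}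
  order : PartialOrder V
  adj : ∀ u : {v // v ∉ Γ.outputs}, Γ.graph.Adj (f u) u
  lt_f : ∀ u : {v // v ∉ Γ.outputs}, order.lt u (f u)
  lt_of_adj : ∀ (u : {v // v ∉ Γ.outputs}) (v : V), Γ.graph.Adj (f u) v → (u : V) ≠ v → order.lt u v

def HasFlow (Γ : OpenGraph V) : Prop := Nonempty Γ.Flow

/-- The vertices of the diagram of an open graph: the disjoint union `V + E + I + O`. -/
inductive DVertex (Γ : OpenGraph V)
  | ofV (v : V)
  | ofE (e : Γ.graph.edgeSet)
  | ofI (i : Γ.inputs)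
  | ofO (o : Γ.outputs)

/-- The edges of the diagram of an open graph: one for every incident pair of an edge `e` and a vertex
`u`, and one for every input and every output. -/
inductive DEdge (Γ : OpenGraph V)
  | inc (e : Γ.graph.edgeSet) (u : {u : V // u ∈ e.1})
  | inp (i : Γ.inputs)
  | out (o : Γ.outputs)

def dEnds (Γ : OpenGraph V) : Γ.DEdge → Sym2 Γ.DVertex
  | .inc e u => s(.ofV u, .ofE e)
  | .inp i => s(.ofI i, .ofV i)
  | .out o => s(.ofO o, .ofV o)

/-- The vertices from `V` are `Z` spiders with phase `0`, those from `E` are Hadamard vertices, those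
from `I` and `O` are the inputs and outputs, ordered as in `V`. -/
noncomputable def dKind [LinearOrder V] (Γ : OpenGraph V) :
    Γ.DVertex → Kind Γ.inputs.card Γ.outputs.card
  | .ofV _ => .spider .Z 0
  | .ofE _ => .hadamard
  | .ofI i => .input ((Γ.inputs.orderIsoOfFin rfl).symm i)
  | .ofO o => .output ((Γ.outputs.orderIsoOfFin rfl).symm o)

theorem finite_dVertex [Finite V] (Γ : OpenGraph V) : Finite Γ.DVertex := by
  let g : V ⊕ Γ.graph.edgeSet ⊕ Γ.inputs ⊕ Γ.outputs → Γ.DVertex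
    | .inl v => .ofV v
    | .inr (.inl e) => .ofE e
    | .inr (.inr (.inl i)) => .ofI i
    | .inr (.inr (.inr o)) => .ofO o
  refine Finite.of_surjective g ?_
  rintro (v | e | i | o)
  exacts [⟨.inl v, rfl⟩, ⟨.inr (.inl e), rfl⟩, ⟨.inr (.inr (.inl i)), rfl⟩,
    ⟨.inr (.inr (.inr o)), rfl⟩]

theorem finite_dEdge [Finite V] (Γ : OpenGraph V) : Finite Γ.DEdge := by
  let g : (Σ e : Γ.graph.edgeSet, {u : V // u ∈ e.1}) ⊕ Γ.inputs ⊕ Γ.outputs → Γ.DEdge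
    | .inl p => .inc p.1 p.2
    | .inr (.inl i) => .inp i
    | .inr (.inr o) => .out o
  refine Finite.of_surjective g ?_
  rintro (⟨e, u⟩ | i | o)
  exacts [⟨.inl ⟨e, u⟩, rfl⟩, ⟨.inr (.inl i), rfl⟩, ⟨.inr (.inr o), rfl⟩]

theorem dEnds_ne_loop (Γ : OpenGraph V) (x : Γ.DVertex) : {e | Γ.dEnds e = s(x, x)} = ∅ := by
  ext e
  rcases e with ⟨e, u⟩ | i | o <;> cases x <;> simp [dEnds]

theorem degree_ofI (Γ : OpenGraph V) (i : Γ.inputs) : degree Γ.dEnds (.ofI i) = 1 := by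
  have h : {e | DVertex.ofI i ∈ Γ.dEnds e} = {.inp i} := by
    ext e
    rcases e with ⟨e, u⟩ | j | o <;> simp [dEnds, eq_comm]
  simp [degree, dEnds_ne_loop, h]

theorem degree_ofO (Γ : OpenGraph V) (o : Γ.outputs) : degree Γ.dEnds (.ofO o) = 1 := by
  have h : {e | DVertex.ofO o ∈ Γ.dEnds e} = {.out o} := by
    ext e
    rcases e with ⟨e, u⟩ | j | o <;> simp [dEnds, eq_comm]
  simp [degree, dEnds_ne_loop, h]

theorem degree_ofE (Γ : OpenGraph V) (e : Γ.graph.edgeSet) : degree Γ.dEnds (.ofE e) = 2 := by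
  obtain ⟨e, he⟩ := e
  induction e with
  | h a b =>
    have hab : a ≠ b := (show Γ.graph.Adj a b from he).ne
    have h : {e' | DVertex.ofE ⟨s(a, b), he⟩ ∈ Γ.dEnds e'} =
        {.inc ⟨s(a, b), he⟩ ⟨a, by simp⟩, .inc ⟨s(a, b), he⟩ ⟨b, by simp⟩} := by
      ext e'
      rcases e' with ⟨⟨e', he'⟩, ⟨u, hu⟩⟩ | j | o
      · simp only [dEnds, Set.mem_ofPred_eq, Sym2.mem_iff, reduceCtorEq, false_or,
          Set.mem_insert_iff, Set.mem_singleton_iff]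
        constructor
        · intro h
          injection h with h
          injection h with h
          subst h
          rcases Sym2.mem_iff.1 hu with rfl | rfl
          · exact Or.inl rfl
          · exact Or.inr rfl
        · rintro (h | h)
          · injection h with h _
            rw [h]
          · injection h with h _
            rw [h]
      · simp [dEnds]
      · simp [dEnds]
    rw [degree, dEnds_ne_loop, h, Set.ncard_pair, Set.ncard_empty]
    simpa using hab

/-- The diagram of an open graph. -/
noncomputable def toDiagram [Finite V] [LinearOrder V] (Γ : OpenGraph V) :
    Diagram Γ.inputs.card Γ.outputs.card where
  V := Γ.DVertex
  E := Γ.DEdge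
  finite_V := Γ.finite_dVertex
  finite_E := Γ.finite_dEdge
  ends := Γ.dEnds
  kind := Γ.dKind
  existsUnique_input i := by
    refine ⟨.ofI (Γ.inputs.orderIsoOfFin rfl i), by simp [dKind], ?_⟩
    rintro (v | e | j | o) h <;> simp [dKind] at h
    simp [← h]
  existsUnique_output i := by
    refine ⟨.ofO (Γ.outputs.orderIsoOfFin rfl i), by simp [dKind], ?_⟩
    rintro (v | e | j | o) h <;> simp [dKind] at h
    simp [← h]
  degree_boundary := by
    rintro (v | e | i | o) h
    exacts [h.elim, h.elim, Γ.degree_ofI i, Γ.degree_ofO o]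
  degree_hadamard := by
    rintro (v | e | i | o) h <;> simp [dKind] at h
    exact Γ.degree_ofE e

end OpenGraph

/-! ### Patterns of the measurement calculus -/

/-- The commands of the measurement calculus on a set `Q` of qubits.  The signal that holds the outcome
of the measurement of a qubit is named by that qubit; a conditional command is controlled by a sum of
signals. -/
inductive Command (Q : Type)
  /-- `N_i`: initialise qubit `i`. -/
  | init (i : Q)
  /-- `E_{ij}`: entangle the qubits `i` and `j`. -/
  | entangle (i j : Q)
  /-- `ˢ[M_i^α]ᵗ`; the unconditional measurement has `s = t = ∅`. -/
  | measure (i : Q) (α : Real.Angle) (s t : Finset Q)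
  /-- `X_i` -/
  | pauliX (i : Q)
  /-- `Z_i` -/
  | pauliZ (i : Q)
  /-- `X_i^s` -/
  | condX (i : Q) (s : Finset Q)
  /-- `Z_i^s` -/
  | condZ (i : Q) (s : Finset Q)

/-- The command acts on the qubit `q`. -/
def Command.ActsOn {Q : Type} : Command Q → Q → Prop
  | .init i, q => q = i
  | .entangle i j, q => q = i ∨ q = j
  | .measure i _ _ _, q => q = i
  | .pauliX i, q => q = i
  | .pauliZ i, q => q = i
  | .condX i _, q => q = i
  | .condZ i _, q => q = i

/-- The command depends on the outcome of the measurement of the qubit `q`. -/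
def Command.DependsOn {Q : Type} : Command Q → Q → Prop
  | .measure _ _ s t, q => q ∈ s ∨ q ∈ t
  | .condX _ s, q => q ∈ s
  | .condZ _ s, q => q ∈ s
  | _, _ => False

/-- The command is a measurement of the qubit `q`. -/
def Command.Measures {Q : Type} : Command Q → Q → Prop
  | .measure i _ _ _, q => q = i
  | _, _ => False

/-- A pattern: a sequence of commands, listed in the order of execution, that satisfies the
determinacy conditions. -/
structure Pattern (Q : Type) where
  commands : List (Command Q)
  entangle_ne : ∀ i j, Command.entangle i j ∈ commands → i ≠ j
  init_first : ∀ l₁ l₂ i, commands = l₁ ++ Command.init i :: l₂ → ∀ c ∈ l₁, ¬ c.ActsOn i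
  measure_last : ∀ l₁ c l₂ i, commands = l₁ ++ c :: l₂ → c.Measures i → ∀ d ∈ l₂, ¬ d.ActsOn i
  depends_measured : ∀ l₁ c l₂ q, commands = l₁ ++ c :: l₂ → c.DependsOn q → ∃ d ∈ l₁, d.Measures q

open Classical in
/-- The geometry of a pattern: the inputs are the qubits that are not initialised, the outputs those that
are not measured, and two qubits are adjacent if they are entangled by some command. -/
noncomputable def Pattern.geometry {Q : Type} [Fintype Q] (P : Pattern Q) : OpenGraph Q where
  graph :=
    { Adj := fun u v => Command.entangle u v ∈ P.commands ∨ Command.entangle v u ∈ P.commands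
      symm := ⟨fun _ _ h => h.symm⟩
      loopless := ⟨fun u h => P.entangle_ne u u (h.elim id id) rfl⟩ }
  inputs := Finset.univ.filter fun q => Command.init q ∉ P.commands
  outputs := Finset.univ.filter fun q => ¬ ∃ c ∈ P.commands, c.Measures q

end ZX

/-! ### Diagrams obtained by local modification -/

namespace ZX.Diagram

variable {m n : ℕ}

/-! A flow cuts the diagram into wires: from an input to its qubit, from a qubit `u` through the
Hadamard vertex of the edge between `u` and `f u` to `f u`, and so on to an output. Injectivity of
`f` keeps the wires disjoint, and only the Hadamard vertices of the other edges remain uncovered.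
Such a vertex, between Z spiders `v` and `w`, is a controlled-Z gate. Since CZ is CNOT conjugated by
a Hadamard on the target, it can be rewritten as a Z spider on the wire leaving `v`, joined to an X
spider that sits between two Hadamard vertices on the wire leaving `w` (`Site.equivalent_pullOut`).

The point is to do this without creating forbidden cycles. A `Layout` therefore assigns real times
that increase along the wires, and each uncovered ("pending") vertex has a time between those of its
neighbouring spiders and of their successors. The flow axioms provide such times (`Flow.layout`).
The latest pending vertex is pulled out first: the new gate becomes the immediate successor of `v`
and of `w`, and the earlier pending vertices still fit in front of it
(`Layout.exists_equivalent_pending_eq_empty`).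

Once nothing is pending, every edge off the wires joins a Z spider and an X spider of equal time.
Hence neighbours of the same type occur only along wires, where a phase-free spider of a suitable
colour separates them (`Layout.exists_equivalent_isThreeColoured`). Moreover time never decreases
along a closed walk that runs against no wire, so it is constant there and the walk contains no wire
edge. This yields the cycle condition (`Layout.circuitLike`). -/

/-- A multigraph without loops. -/
def Loopless (D : Diagram m n) : Prop := ∀ e, ¬ (D.ends e).IsDiag

theorem degree_of_loopless {V E : Type} {ends : E → Sym2 V} (h : ∀ e, ¬ (ends e).IsDiag) (v : V) :
    degree ends v = {e | v ∈ ends e}.ncard := by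
  have : {e | ends e = s(v, v)} = ∅ := by
    refine Set.eq_empty_of_forall_notMem fun e (he : ends e = s(v, v)) => h e ?_
    rw [he]
    exact rfl
  simp [degree, this]

/-- The edges of `ends` at `v` correspond, by an injection of edges, to the edges of `ends'` at
`v'`. -/
def SameLegs {V E V' E' : Type} (ends : E → Sym2 V) (v : V) (ends' : E' → Sym2 V') (v' : V') : Prop :=
  ∃ g : E → E', Function.Injective g ∧ ∀ e', v' ∈ ends' e' ↔ ∃ e, g e = e' ∧ v ∈ ends e

theorem SameLegs.degree_eq {V E V' E' : Type} {ends : E → Sym2 V} {v : V} {ends' : E' → Sym2 V'}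
    {v' : V'} (h : SameLegs ends v ends' v') (hl : ∀ e, ¬ (ends e).IsDiag)
    (hl' : ∀ e, ¬ (ends' e).IsDiag) : degree ends' v' = degree ends v := by
  obtain ⟨g, hg, h⟩ := h
  rw [degree_of_loopless hl, degree_of_loopless hl', ← Set.ncard_image_of_injective _ hg]
  congr 1
  ext e'
  simp [h, and_comm]

theorem sameLegs_inl {V E N F : Type} {ends : E → Sym2 V} {v : V} {e₀ : E → Sym2 (V ⊕ N)}
    {e₁ : F → Sym2 (V ⊕ N)} (h₀ : ∀ e, .inl v ∈ e₀ e ↔ v ∈ ends e) (h₁ : ∀ f, .inl v ∉ e₁ f) :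
    SameLegs ends v (Sum.elim e₀ e₁) (.inl v) := by
  refine ⟨.inl, Sum.inl_injective, ?_⟩
  rintro (e | f)
  · simp [h₀]
  · simp [h₁]

/-- A diagram obtained from `D` by adding vertices `N` and edges `F`, and by changing the ends of the
edges of `D` and the kinds of its vertices, in such a way that at the boundary and Hadamard vertices
the incident edges are kept. -/
def extend (D : Diagram m n) {N F : Type} [Finite N] [Finite F] (k₀ : D.V → Kind m n)
    (k₁ : N → Kind m n) (e₀ : D.E → Sym2 (D.V ⊕ N)) (e₁ : F → Sym2 (D.V ⊕ N))
    (hD : D.Loopless) (hk₀ : ∀ v, k₀ v = D.kind v ∨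
      (¬ (D.kind v).IsBoundary ∧ ¬ (k₀ v).IsBoundary ∧ k₀ v ≠ .hadamard))
    (hk₁ : ∀ a, ¬ (k₁ a).IsBoundary)
    (he₀ : ∀ e, ¬ (e₀ e).IsDiag) (he₁ : ∀ f, ¬ (e₁ f).IsDiag)
    (hinc : ∀ v, k₀ v = D.kind v → (k₀ v).IsBoundary ∨ k₀ v = .hadamard →
      SameLegs D.ends v (Sum.elim e₀ e₁) (.inl v))
    (hdeg : ∀ a, k₁ a = .hadamard → {e | .inr a ∈ Sum.elim e₀ e₁ e}.ncard = 2) : Diagram m n where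
  V := D.V ⊕ N
  E := D.E ⊕ F
  finite_V := by have := D.finite_V; infer_instance
  finite_E := by have := D.finite_E; infer_instance
  ends := Sum.elim e₀ e₁
  kind := Sum.elim k₀ k₁
  existsUnique_input i := by
    obtain ⟨v, hv, hv'⟩ := D.existsUnique_input i
    refine ⟨.inl v, ?_, ?_⟩
    · rcases hk₀ v with h | h
      · exact h.trans hv
      · exact (h.1 (by rw [hv]; trivial)).elim
    · rintro (w | a) hw
      · rcases hk₀ w with h | h
        · rw [hv' w (h.symm.trans hw)]
        · exact (h.2.1 (by rw [show k₀ w = _ from hw]; trivial)).elim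
      · exact (hk₁ a (by rw [show k₁ a = _ from hw]; trivial)).elim
  existsUnique_output i := by
    obtain ⟨v, hv, hv'⟩ := D.existsUnique_output i
    refine ⟨.inl v, ?_, ?_⟩
    · rcases hk₀ v with h | h
      · exact h.trans hv
      · exact (h.1 (by rw [hv]; trivial)).elim
    · rintro (w | a) hw
      · rcases hk₀ w with h | h
        · rw [hv' w (h.symm.trans hw)]
        · exact (h.2.1 (by rw [show k₀ w = _ from hw]; trivial)).elim
      · exact (hk₁ a (by rw [show k₁ a = _ from hw]; trivial)).elim
  degree_boundary := by
    rintro (v | a) hv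
    · replace hv : (k₀ v).IsBoundary := hv
      have hk : k₀ v = D.kind v := (hk₀ v).resolve_right fun h => h.2.1 hv
      rw [(hinc v hk (.inl hv)).degree_eq hD (by rintro (e | f); exacts [he₀ e, he₁ f])]
      exact D.degree_boundary v (hk ▸ hv)
    · exact (hk₁ a hv).elim
  degree_hadamard := by
    rintro (v | a) hv
    · replace hv : k₀ v = .hadamard := hv
      have hk : k₀ v = D.kind v := (hk₀ v).resolve_right fun h => h.2.2 hv
      rw [(hinc v hk (.inr hv)).degree_eq hD (by rintro (e | f); exacts [he₀ e, he₁ f])]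
      exact D.degree_hadamard v (hk ▸ hv)
    · rw [degree_of_loopless (by rintro (e | f); exacts [he₀ e, he₁ f])]
      exact hdeg a hv

/-! ### Splitting a spider -/

open Classical in
/-- The end `z` of the edge `e` after the legs of `v` in `M` have been moved to a new vertex. -/
noncomputable def moveEnd {V E : Type} (v : V) (M : Set E) (e : E) (z : V) : V ⊕ Unit :=
  if z = v ∧ e ∈ M then .inr () else .inl z

theorem moveEnd_injective {V E : Type} (v : V) (M : Set E) (e : E) :
    Function.Injective (moveEnd v M e) := by
  intro a b h
  unfold moveEnd at h
  split_ifs at h with h₁ h₂ h₂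
  · exact h₁.1.trans h₂.1.symm
  · exact Sum.inl_injective h

/-- The spider `v` is split: the legs in `M` are moved to a new spider with phase `0`, which is joined
to `v` by a new edge. -/
noncomputable def split (D : Diagram m n) (hD : D.Loopless) (c : Colour) (α : Real.Angle) (v : D.V)
    (hv : D.kind v = .spider c α) (M : Set D.E) : Diagram m n :=
  D.extend (N := Unit) (F := Unit) D.kind (fun _ => .spider c 0)
    (fun e => (D.ends e).map (moveEnd v M e)) (fun _ => s(.inl v, .inr ())) hD
    (fun _ => .inl rfl) (fun _ => id)
    (fun e => by rw [Sym2.isDiag_map (moveEnd_injective v M e)]; exact hD e)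
    (fun _ => by simp)
    (fun u _ hu => by
      have huv : u ≠ v := by rintro rfl; simp [hv, Kind.IsBoundary] at hu
      have hm : ∀ e z, moveEnd v M e z = .inl u ↔ z = u := by
        intro e z
        unfold moveEnd
        split_ifs with h
        · simpa [h.1] using huv.symm
        · simp
      exact sameLegs_inl (by simp [Sym2.mem_map, hm]) (by simp [huv]))
    (fun _ h => by cases h)

theorem split_ends (D : Diagram m n) (hD : D.Loopless) (c : Colour) (α : Real.Angle) (v : D.V)
    (hv : D.kind v = .spider c α) (M : Set D.E) {e : D.E} {a b : D.V} (h : D.ends e = s(a, b)) :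
    (D.split hD c α v hv M).ends (.inl e) = s(moveEnd v M e a, moveEnd v M e b) :=
  congrArg (Sym2.map (moveEnd v M e)) h

theorem split_loopless (D : Diagram m n) (hD : D.Loopless) (c : Colour) (α : Real.Angle) (v : D.V)
    (hv : D.kind v = .spider c α) (M : Set D.E) : (D.split hD c α v hv M).Loopless := by
  rintro (e | f)
  · exact (Sym2.isDiag_map (moveEnd_injective v M e)).not.2 (hD e)
  · change ¬ (s(Sum.inl v, Sum.inr ()) : Sym2 (D.V ⊕ Unit)).IsDiag
    simp

theorem spiderRule_split (D : Diagram m n) (hD : D.Loopless) (c : Colour) (α : Real.Angle) (v : D.V)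
    (hv : D.kind v = .spider c α) (M : Set D.E) : SpiderRule D (D.split hD c α v hv M) := by
  refine ⟨c, α, 0, v, Equiv.optionEquivSumPUnit _, Equiv.optionEquivSumPUnit _, by simpa using hv, hv,
    rfl, fun _ _ => rfl, rfl, fun e => ?_⟩
  -- Fusion sends the new vertex back to `v`, and only ends equal to `v` were moved, so every end is
  -- recovered.
  have h : ∀ z, ((Equiv.optionEquivSumPUnit D.V).symm (moveEnd v M e z)).getD v = z := by
    intro z
    unfold moveEnd
    split_ifs with h
    · exact h.1.symm
    · rfl
  refine (Sym2.map_map (g := _) (f := _) (D.ends e)).trans ?_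
  exact (congrArg (fun f => Sym2.map f (D.ends e)) (funext h)).trans (by simp)

/-! ### Subdividing an edge -/

-- At `y` the edge `e₀` is replaced by the last piece `f₀` of the new path. At every other vertex
-- all old edges keep their names, and `e₀` survives as the first piece of the path.
open Classical in
theorem sameLegs_subdivide {V E N F : Type} {ends : E → Sym2 V} {e₀ : E} {x y : V}
    (h₀ : ends e₀ = s(x, y)) (hxy : x ≠ y) {a : N} {e₁ : F → Sym2 (V ⊕ N)} {f₀ : F} {b : N}
    (hf₀ : e₁ f₀ = s(.inr b, .inl y)) (hf : ∀ f ≠ f₀, ∀ v, .inl v ∉ e₁ f) (v : V) :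
    SameLegs ends v
      (Sum.elim (fun e => if e = e₀ then s(.inl x, .inr a) else (ends e).map .inl) e₁) (.inl v) := by
  by_cases hv : v = y
  · subst hv
    refine ⟨fun e => if e = e₀ then .inr f₀ else .inl e, fun e e' h => ?_, ?_⟩
    · dsimp only at h
      split_ifs at h with h₁ h₂ h₂
      · exact h₁.trans h₂.symm
      · exact Sum.inl_injective h
    · rintro (e | f)
      · by_cases h : e = e₀
        · subst h
          simp only [Sum.elim_inl, if_true, Sym2.mem_iff, Sum.inl.injEq, reduceCtorEq, or_false,
            hxy.symm, false_iff]
          rintro ⟨e', he', -⟩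
          split_ifs at he' with h
          exact h (Sum.inl_injective he')
        · simp only [Sum.elim_inl, h, if_false, Sym2.mem_map, Sum.inl.injEq, exists_eq_right]
          constructor
          · intro he
            exact ⟨e, by simp [h], he⟩
          · rintro ⟨e', he', hv⟩
            split_ifs at he'
            rwa [← Sum.inl_injective he']
      · by_cases h : f = f₀
        · subst h
          simp only [Sum.elim_inr, hf₀, Sym2.mem_iff, or_true, true_iff]
          exact ⟨e₀, by simp, by simp [h₀]⟩
        · simp only [Sum.elim_inr, hf f h, false_iff]
          rintro ⟨e', he', -⟩
          split_ifs at he'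
          exact h (Sum.inr_injective he').symm
  · refine sameLegs_inl (fun e => ?_) fun f => ?_
    · split_ifs with h
      · simp [h, h₀, hv]
      · simp
    · by_cases h : f = f₀
      · simp [h, hf₀, hv]
      · exact hf f h v

theorem not_isDiag_subdivide {V E N : Type} {ends : E → Sym2 V} (hl : ∀ e, ¬ (ends e).IsDiag)
    (x : V) (a : N) (p : Prop) [Decidable p] (e : E) :
    ¬ (if p then s(.inl x, .inr a) else (ends e).map .inl : Sym2 (V ⊕ N)).IsDiag := by
  split_ifs with h
  · simp
  · rw [Sym2.isDiag_map Sum.inl_injective]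
    exact hl e

open Classical in
/-- The edge `e₀`, joining `x` and `y`, is replaced by a path through two new Hadamard vertices. -/
noncomputable def insertHadamards (D : Diagram m n) (hD : D.Loopless) (e₀ : D.E) (x y : D.V)
    (h₀ : D.ends e₀ = s(x, y)) : Diagram m n :=
  D.extend (N := Bool) (F := Bool) D.kind (fun _ => .hadamard)
    (fun e => if e = e₀ then s(.inl x, .inr false) else (D.ends e).map .inl)
    (fun b => if b then s(.inr true, .inl y) else s(.inr false, .inr true)) hD
    (fun _ => .inl rfl) (fun _ => id)
    (fun e => not_isDiag_subdivide hD x false _ e)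
    (fun b => by cases b <;> simp)
    (fun u _ _ => sameLegs_subdivide h₀ (by rintro rfl; exact hD e₀ (by simp [h₀])) (f₀ := true) rfl
      (by simp) u)
    (fun b _ => by
      cases b
      · rw [← Set.ncard_pair (a := (.inl e₀ : D.E ⊕ Bool)) (b := .inr false) (by simp)]
        congr 1
        ext (e | f)
        · by_cases h : e = e₀ <;> simp [h]
        · cases f <;> simp
      · rw [← Set.ncard_pair (a := (.inr true : D.E ⊕ Bool)) (b := .inr false) (by simp)]
        congr 1
        ext (e | f)
        · by_cases h : e = e₀ <;> simp [h]
        · cases f <;> simp)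

theorem insertHadamards_ends_self (D : Diagram m n) (hD : D.Loopless) (e₀ : D.E) (x y : D.V)
    (h₀ : D.ends e₀ = s(x, y)) :
    (D.insertHadamards hD e₀ x y h₀).ends (.inl e₀) = s(.inl x, .inr false) := if_pos rfl

theorem insertHadamards_ends_of_ne (D : Diagram m n) (hD : D.Loopless) (e₀ : D.E) (x y : D.V)
    (h₀ : D.ends e₀ = s(x, y)) {e : D.E} (he : e ≠ e₀) {a b : D.V} (h : D.ends e = s(a, b)) :
    (D.insertHadamards hD e₀ x y h₀).ends (.inl e) = s(.inl a, .inl b) :=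
  (if_neg he).trans (congrArg (Sym2.map Sum.inl) h)

theorem insertHadamards_loopless (D : Diagram m n) (hD : D.Loopless) (e₀ : D.E) (x y : D.V)
    (h₀ : D.ends e₀ = s(x, y)) : (D.insertHadamards hD e₀ x y h₀).Loopless := by
  classical
  rintro (e | (_ | _))
  · exact not_isDiag_subdivide hD x false _ e
  · change ¬ (s(.inr false, .inr true) : Sym2 (D.V ⊕ Bool)).IsDiag
    simp
  · change ¬ (s(.inr true, .inl y) : Sym2 (D.V ⊕ Bool)).IsDiag
    simp

theorem hCancelRule_insertHadamards (D : Diagram m n) (hD : D.Loopless) (e₀ : D.E) (x y : D.V)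
    (h₀ : D.ends e₀ = s(x, y)) : HCancelRule D (D.insertHadamards hD e₀ x y h₀) :=
  ⟨e₀, x, y, .refl _, .refl _, h₀, fun _ => rfl, fun _ => rfl, if_pos rfl, rfl, rfl,
    fun _ he => if_neg he⟩

open Classical in
/-- The edge `e₀`, joining `x` and `y`, is subdivided by a spider with phase `0`. -/
noncomputable def insertSpider (D : Diagram m n) (hD : D.Loopless) (c : Colour) (e₀ : D.E) (x y : D.V)
    (h₀ : D.ends e₀ = s(x, y)) : Diagram m n :=
  D.extend (N := Unit) (F := Unit) D.kind (fun _ => .spider c 0)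
    (fun e => if e = e₀ then s(.inl x, .inr ()) else (D.ends e).map .inl)
    (fun _ => s(.inr (), .inl y)) hD
    (fun _ => .inl rfl) (fun _ => id)
    (fun e => not_isDiag_subdivide hD x () _ e)
    (fun b => by simp)
    (fun u _ _ => sameLegs_subdivide h₀ (by rintro rfl; exact hD e₀ (by simp [h₀])) (f₀ := ()) rfl
      (by simp) u)
    (fun _ h => by cases h)

theorem identityRule_insertSpider (D : Diagram m n) (hD : D.Loopless) (c : Colour) (e₀ : D.E)
    (x y : D.V) (h₀ : D.ends e₀ = s(x, y)) : IdentityRule D (D.insertSpider hD c e₀ x y h₀) :=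
  ⟨c, e₀, x, y, Equiv.optionEquivSumPUnit _, Equiv.optionEquivSumPUnit _, h₀, fun _ => rfl, rfl,
    if_pos rfl, rfl, fun _ he => if_neg he⟩

end ZX.Diagram

namespace ZX.Diagram

variable {m n : ℕ}

/-! ### Pulling a controlled phase out of a diagram -/

/-- A Hadamard vertex `h` between two `Z` spiders `v` and `w`, together with a further leg of `v` (to
`x`) and of `w` (to `y`). -/
structure Site (D : Diagram m n) where
  loopless : D.Loopless
  (h v w x y : D.V)
  (ev ew ox oy : D.E)
  (α β : Real.Angle)
  kind_h : D.kind h = .hadamard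
  kind_v : D.kind v = .spider .Z α
  kind_w : D.kind w = .spider .Z β
  ends_ev : D.ends ev = s(v, h)
  ends_ew : D.ends ew = s(w, h)
  ends_ox : D.ends ox = s(v, x)
  ends_oy : D.ends oy = s(w, y)
  eq_or_eq : ∀ e, h ∈ D.ends e → e = ev ∨ e = ew
  v_ne_w : v ≠ w
  x_ne_h : x ≠ h
  y_ne_h : y ≠ h
  x_ne_w : x ≠ w
  y_ne_v : y ≠ v

namespace Site

variable {D : Diagram m n} (S : D.Site)

theorem v_ne_h : S.v ≠ S.h := fun h => by simpa [h, S.kind_h] using S.kind_v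

theorem w_ne_h : S.w ≠ S.h := fun h => by simpa [h, S.kind_h] using S.kind_w

theorem v_ne_x : S.v ≠ S.x := fun h => S.loopless S.ox (by simp [S.ends_ox, h])

theorem w_ne_y : S.w ≠ S.y := fun h => S.loopless S.oy (by simp [S.ends_oy, h])

theorem ev_ne_ew : S.ev ≠ S.ew := fun h => by
  have := S.ends_ev
  rw [h, S.ends_ew] at this
  simp [S.v_ne_w.symm, S.w_ne_h] at this

theorem h_notMem_ox : S.h ∉ D.ends S.ox := by
  simp [S.ends_ox, S.v_ne_h.symm, S.x_ne_h.symm]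

theorem h_notMem_oy : S.h ∉ D.ends S.oy := by
  simp [S.ends_oy, S.w_ne_h.symm, S.y_ne_h.symm]

theorem ev_ne_ox : S.ev ≠ S.ox := fun h => S.h_notMem_ox (by simp [← h, S.ends_ev])

theorem ev_ne_oy : S.ev ≠ S.oy := fun h => S.h_notMem_oy (by simp [← h, S.ends_ev])

theorem ew_ne_ox : S.ew ≠ S.ox := fun h => S.h_notMem_ox (by simp [← h, S.ends_ew])

theorem ew_ne_oy : S.ew ≠ S.oy := fun h => S.h_notMem_oy (by simp [← h, S.ends_ew])

theorem ox_ne_oy : S.ox ≠ S.oy := fun h => by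
  have := S.ends_ox
  rw [h, S.ends_oy] at this
  simp [S.v_ne_w.symm, S.y_ne_v] at this

open Classical in
/-- The ends of the old edges after pulling out the controlled phase. -/
noncomputable def oldEnds (e : D.E) : Sym2 (D.V ⊕ Option Bool) :=
  if e = S.ev then s(.inr none, .inl S.h)
  else if e = S.ew then s(.inl S.h, .inr (some false))
  else if e = S.ox then s(.inr none, .inl S.x)
  else if e = S.oy then s(.inr (some true), .inl S.y)
  else (D.ends e).map .inl

/-- The ends of the new edges after pulling out the controlled phase. -/
def newEnds : Option Bool → Sym2 (D.V ⊕ Option Bool)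
  | none => s(.inl S.v, .inr none)
  | some false => s(.inl S.w, .inr (some false))
  | some true => s(.inl S.h, .inr (some true))

theorem oldEnds_ev : S.oldEnds S.ev = s(.inr none, .inl S.h) := if_pos rfl

theorem oldEnds_ew : S.oldEnds S.ew = s(.inl S.h, .inr (some false)) := by
  simp [oldEnds, S.ev_ne_ew.symm]

theorem oldEnds_ox : S.oldEnds S.ox = s(.inr none, .inl S.x) := by
  simp [oldEnds, S.ev_ne_ox.symm, S.ew_ne_ox.symm]

theorem oldEnds_oy : S.oldEnds S.oy = s(.inr (some true), .inl S.y) := by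
  simp [oldEnds, S.ev_ne_oy.symm, S.ew_ne_oy.symm, S.ox_ne_oy.symm]

theorem oldEnds_of_ne {e : D.E} (h₁ : e ≠ S.ev) (h₂ : e ≠ S.ew) (h₃ : e ≠ S.ox) (h₄ : e ≠ S.oy) :
    S.oldEnds e = (D.ends e).map .inl := by
  simp [oldEnds, h₁, h₂, h₃, h₄]

theorem edge_cases (e : D.E) : e = S.ev ∨ e = S.ew ∨ e = S.ox ∨ e = S.oy ∨
    (e ≠ S.ev ∧ e ≠ S.ew ∧ e ≠ S.ox ∧ e ≠ S.oy) := by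
  tauto

theorem not_isDiag_oldEnds (e : D.E) : ¬ (S.oldEnds e).IsDiag := by
  rcases S.edge_cases e with rfl | rfl | rfl | rfl | ⟨h₁, h₂, h₃, h₄⟩
  · simp [S.oldEnds_ev]
  · simp [S.oldEnds_ew]
  · simp [S.oldEnds_ox]
  · simp [S.oldEnds_oy]
  · rw [S.oldEnds_of_ne h₁ h₂ h₃ h₄, Sym2.isDiag_map Sum.inl_injective]
    exact S.loopless e

theorem not_isDiag_newEnds (f : Option Bool) : ¬ (S.newEnds f).IsDiag := by
  rcases f with _ | _ | _ <;> simp [newEnds]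

theorem inl_mem_oldEnds_iff {u : D.V} (hh : u ≠ S.h) (hv : u ≠ S.v) (hw : u ≠ S.w) (e : D.E) :
    .inl u ∈ S.oldEnds e ↔ u ∈ D.ends e := by
  rcases S.edge_cases e with rfl | rfl | rfl | rfl | ⟨h₁, h₂, h₃, h₄⟩
  · simp [S.oldEnds_ev, S.ends_ev, hh, hv]
  · simp [S.oldEnds_ew, S.ends_ew, hh, hw]
  · simp [S.oldEnds_ox, S.ends_ox, hv]
  · simp [S.oldEnds_oy, S.ends_oy, hw]
  · simp [S.oldEnds_of_ne h₁ h₂ h₃ h₄]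

open Classical in
/-- The vertex `h` becomes an `X` spider on the wire `w y`, between two new Hadamard vertices; it is
joined to a new `Z` spider on the wire `v x`. -/
noncomputable def pullOut : Diagram m n :=
  D.extend (N := Option Bool) (F := Option Bool)
    (fun u => if u = S.h then .spider .X 0 else D.kind u)
    (fun a => if a = none then .spider .Z 0 else .hadamard)
    S.oldEnds S.newEnds S.loopless
    (fun u => by
      by_cases h : u = S.h
      -- Only `h` changes its kind. As a spider it is free of the degree condition, so it may
      -- acquire a third leg.
      · right
        simp [h, S.kind_h, Kind.IsBoundary]
      · simp [h])
    (fun a => by rcases a with _ | _ <;> simp [Kind.IsBoundary])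
    S.not_isDiag_oldEnds S.not_isDiag_newEnds
    (fun u hu hu' => by
      have hh : u ≠ S.h := by
        rintro rfl
        simp [S.kind_h] at hu
      rw [hu] at hu'
      have hv : u ≠ S.v := by
        rintro rfl
        simp [S.kind_v, Kind.IsBoundary] at hu'
      have hw : u ≠ S.w := by
        rintro rfl
        simp [S.kind_w, Kind.IsBoundary] at hu'
      refine sameLegs_inl (S.inl_mem_oldEnds_iff hh hv hw) fun f => ?_
      rcases f with _ | _ | _ <;> simp [newEnds, hh, hv, hw])
    (fun a ha => by
      rcases a with _ | _ | _
      · simp at ha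
      · rw [← Set.ncard_pair (a := (.inl S.ew : D.E ⊕ Option Bool)) (b := .inr (some false)) (by simp)]
        congr 1
        ext (e | f)
        · rcases S.edge_cases e with rfl | rfl | rfl | rfl | ⟨h₁, h₂, h₃, h₄⟩
          · simp [S.oldEnds_ev, S.ev_ne_ew]
          · simp [S.oldEnds_ew]
          · simp [S.oldEnds_ox, S.ew_ne_ox.symm]
          · simp [S.oldEnds_oy, S.ew_ne_oy.symm]
          · simp [S.oldEnds_of_ne h₁ h₂ h₃ h₄, h₂]
        · rcases f with _ | _ | _ <;> simp [newEnds]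
      · rw [← Set.ncard_pair (a := (.inl S.oy : D.E ⊕ Option Bool)) (b := .inr (some true)) (by simp)]
        congr 1
        ext (e | f)
        · rcases S.edge_cases e with rfl | rfl | rfl | rfl | ⟨h₁, h₂, h₃, h₄⟩
          · simp [S.oldEnds_ev, S.ev_ne_oy]
          · simp [S.oldEnds_ew, S.ew_ne_oy]
          · simp [S.oldEnds_ox, S.ox_ne_oy]
          · simp [S.oldEnds_oy]
          · simp [S.oldEnds_of_ne h₁ h₂ h₃ h₄, h₄]
        · rcases f with _ | _ | _ <;> simp [newEnds])

/-! #### Equivalence -/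

/-- The diagram `D` with the legs to `h` and `x` of `v` moved to a new `Z` spider. -/
noncomputable def stage₁ : Diagram m n :=
  D.split S.loopless .Z S.α S.v S.kind_v {S.ev, S.ox}

theorem stage₁_loopless : S.stage₁.Loopless := split_loopless _ _ _ _ _ _ _

/-- The diagram `S.stage₁` with the legs to `h` and `y` of `w` moved to a new `Z` spider. -/
noncomputable def stage₂ : Diagram m n :=
  S.stage₁.split S.stage₁_loopless .Z S.β (.inl S.w) S.kind_w {.inl S.ew, .inl S.oy}

theorem stage₂_loopless : S.stage₂.Loopless := split_loopless _ _ _ _ _ _ _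

/-- The diagram `S.stage₂` with a pair of Hadamard vertices between `w` and the spider split off
from it. -/
noncomputable def stage₃ : Diagram m n :=
  S.stage₂.insertHadamards S.stage₂_loopless (.inr ()) (.inl (.inl S.w)) (.inr ()) rfl

theorem stage₃_loopless : S.stage₃.Loopless := insertHadamards_loopless _ _ _ _ _ _

/-- The end `z` of the edge `e` in `S.stage₂`. -/
noncomputable def moved (e : D.E) (z : D.V) : (D.V ⊕ Unit) ⊕ Unit :=
  moveEnd (E := D.E ⊕ Unit) (.inl S.w) {.inl S.ew, .inl S.oy} (.inl e)
    (moveEnd S.v {S.ev, S.ox} e z)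

theorem stage₃_ends_inl {e : D.E} {a b : D.V} (h : D.ends e = s(a, b)) :
    S.stage₃.ends (.inl (.inl (.inl e))) =
      s(.inl (S.moved e a),
        .inl (S.moved e b)) :=
  insertHadamards_ends_of_ne _ _ _ _ _ _ Sum.inl_ne_inr
    (split_ends _ _ _ _ _ _ _ (split_ends _ _ _ _ _ _ _ h))

theorem stage₃_ends_oy :
    S.stage₃.ends (.inl (.inl (.inl S.oy))) = s(.inl (.inr ()), .inl (.inl (.inl S.y))) := by
  rw [S.stage₃_ends_inl S.ends_oy]
  simp [moved, moveEnd, S.v_ne_w.symm, S.y_ne_v, S.w_ne_y.symm]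
  rfl

/-- The diagram `S.stage₃` with a pair of Hadamard vertices between `y` and the spider split off
from `w`. -/
noncomputable def stage₄ : Diagram m n :=
  S.stage₃.insertHadamards S.stage₃_loopless (.inl (.inl (.inl S.oy))) _ _ S.stage₃_ends_oy

theorem equivalent_stage₄ : D.Equivalent S.stage₄ :=
  .trans _ _ _ (.rel _ _ (.spider (spiderRule_split _ _ _ _ _ _ _))) <|
  .trans _ S.stage₂ _ (.rel S.stage₁ _ (.spider (spiderRule_split _ _ _ _ _ _ _))) <|
  .trans _ S.stage₃ _ (.rel S.stage₂ _ (.hCancel (hCancelRule_insertHadamards _ _ _ _ _ _))) <|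
  .rel S.stage₃ _ (.hCancel (hCancelRule_insertHadamards _ _ _ _ _ _))

theorem stage₄_ends_inl {e : D.E} (he : e ≠ S.oy) {a b : D.V} (h : D.ends e = s(a, b)) :
    S.stage₄.ends (.inl (.inl (.inl (.inl e)))) =
      s(.inl (.inl (S.moved e a)),
        .inl (.inl (S.moved e b))) :=
  insertHadamards_ends_of_ne _ _ _ _ _ _
    (fun h => he (Sum.inl_injective (Sum.inl_injective (Sum.inl_injective h)))) (S.stage₃_ends_inl h)

theorem stage₄_ends_ev :
    S.stage₄.ends (.inl (.inl (.inl (.inl S.ev)))) =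
      s(.inl (.inl (.inl (.inr ()))), .inl (.inl (.inl (.inl S.h)))) := by
  rw [S.stage₄_ends_inl S.ev_ne_oy S.ends_ev]
  simp [moved, moveEnd, S.v_ne_h.symm, S.w_ne_h.symm]
  rfl

theorem stage₄_ends_ew :
    S.stage₄.ends (.inl (.inl (.inl (.inl S.ew)))) =
      s(.inl (.inl (.inr ())), .inl (.inl (.inl (.inl S.h)))) := by
  rw [S.stage₄_ends_inl S.ew_ne_oy S.ends_ew]
  simp [moved, moveEnd, S.v_ne_h.symm, S.w_ne_h.symm, S.v_ne_w.symm]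
  rfl

theorem stage₄_ends_ox :
    S.stage₄.ends (.inl (.inl (.inl (.inl S.ox)))) =
      s(.inl (.inl (.inl (.inr ()))), .inl (.inl (.inl (.inl S.x)))) := by
  rw [S.stage₄_ends_inl S.ox_ne_oy S.ends_ox]
  simp [moved, moveEnd, S.v_ne_x.symm, S.x_ne_w]
  rfl

theorem stage₄_ends_oy :
    S.stage₄.ends (.inl (.inl (.inl (.inl S.oy)))) = s(.inl (.inl (.inr ())), .inr false) :=
  insertHadamards_ends_self _ _ _ _ _ _

theorem stage₄_ends_of_ne {e : D.E} (h₁ : e ≠ S.ev) (h₂ : e ≠ S.ew) (h₃ : e ≠ S.ox) (h₄ : e ≠ S.oy)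
    {a b : D.V} (h : D.ends e = s(a, b)) :
    S.stage₄.ends (.inl (.inl (.inl (.inl e)))) =
      s(.inl (.inl (.inl (.inl a))), .inl (.inl (.inl (.inl b)))) := by
  rw [S.stage₄_ends_inl h₄ h]
  simp [moved, moveEnd, h₁, h₂, h₃, h₄]
  rfl

theorem stage₄_ends_v :
    S.stage₄.ends (.inl (.inl (.inl (.inr ())))) =
      s(.inl (.inl (.inl (.inl S.v))), .inl (.inl (.inl (.inr ())))) := by
  have h : S.stage₂.ends (.inl (.inr ())) = s(.inl (.inl S.v), .inl (.inr ())) := by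
    refine (split_ends S.stage₁ _ _ _ _ _ _ (a := .inl S.v) (b := .inr ()) rfl).trans ?_
    refine congrArg₂ (s(·, ·)) (if_neg ?_) (if_neg ?_)
    all_goals rintro ⟨-, h | h⟩ <;> cases h
  exact insertHadamards_ends_of_ne _ _ _ _ _ _ (fun h => by cases h)
    (insertHadamards_ends_of_ne _ _ _ _ _ _ (fun h => by cases h) h)

theorem stage₄_ends_w :
    S.stage₄.ends (.inl (.inl (.inr ()))) =
      s(.inl (.inl (.inl (.inl S.w))), .inl (.inr false)) :=
  insertHadamards_ends_of_ne _ _ _ _ _ _ (fun h => by cases h)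
    (insertHadamards_ends_self _ _ _ _ _ _)

theorem stage₄_ends_false :
    S.stage₄.ends (.inl (.inr false)) = s(.inl (.inr false), .inl (.inr true)) :=
  insertHadamards_ends_of_ne _ _ _ _ _ _ (fun h => by cases h) rfl

theorem stage₄_ends_true :
    S.stage₄.ends (.inl (.inr true)) = s(.inl (.inr true), .inl (.inl (.inr ()))) :=
  insertHadamards_ends_of_ne _ _ _ _ _ _ (fun h => by cases h) rfl

open Classical in
/-- The vertices of `S.stage₄`, as vertices of the result of the colour change of the vertex `h` of
`S.pullOut`. -/
noncomputable def vertexEquiv {V : Type} (h : V) :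
    (V ⊕ Option Bool) ⊕ Option Bool ≃ (((V ⊕ Unit) ⊕ Unit) ⊕ Bool) ⊕ Bool where
  toFun
    | .inl (.inl u) => if u = h then .inl (.inl (.inr ())) else .inl (.inl (.inl (.inl u)))
    | .inl (.inr none) => .inl (.inl (.inl (.inr ())))
    | .inl (.inr (some false)) => .inl (.inr false)
    | .inl (.inr (some true)) => .inr true
    | .inr none => .inl (.inl (.inl (.inl h)))
    | .inr (some false) => .inl (.inr true)
    | .inr (some true) => .inr false
  invFun
    | .inl (.inl (.inl (.inl u))) => if u = h then .inr none else .inl (.inl u)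
    | .inl (.inl (.inl (.inr _))) => .inl (.inr none)
    | .inl (.inl (.inr _)) => .inl (.inl h)
    | .inl (.inr false) => .inl (.inr (some false))
    | .inl (.inr true) => .inr (some false)
    | .inr false => .inr (some true)
    | .inr true => .inl (.inr (some true))
  left_inv := by
    rintro ((u | _ | _ | _) | _ | _ | _) <;> try simp
    by_cases hu : u = h <;> simp [hu]
  right_inv := by
    rintro ((((u | _) | _) | _ | _) | _ | _) <;> try simp
    by_cases hu : u = h <;> simp [hu]

open Classical in
/-- The edges of `S.stage₄`, as edges of the result of the colour change of the vertex `h` of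
`S.pullOut`. -/
noncomputable def edgeEquiv {E : Type} (p q : E) (hpq : p ≠ q) :
    (E ⊕ Option Bool) ⊕ Option Bool ≃ (((E ⊕ Unit) ⊕ Unit) ⊕ Bool) ⊕ Bool where
  toFun
    | .inl (.inl e) =>
      if e = p then .inl (.inr false) else if e = q then .inr true else .inl (.inl (.inl (.inl e)))
    | .inl (.inr none) => .inl (.inl (.inl (.inr ())))
    | .inl (.inr (some false)) => .inl (.inl (.inr ()))
    | .inl (.inr (some true)) => .inr false
    | .inr none => .inl (.inl (.inl (.inl p)))
    | .inr (some false) => .inl (.inr true)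
    | .inr (some true) => .inl (.inl (.inl (.inl q)))
  invFun
    | .inl (.inl (.inl (.inl e))) =>
      if e = p then .inr none else if e = q then .inr (some true) else .inl (.inl e)
    | .inl (.inl (.inl (.inr _))) => .inl (.inr none)
    | .inl (.inl (.inr _)) => .inl (.inr (some false))
    | .inl (.inr false) => .inl (.inl p)
    | .inl (.inr true) => .inr (some false)
    | .inr false => .inl (.inr (some true))
    | .inr true => .inl (.inl q)
  left_inv := by
    rintro ((u | _ | _ | _) | _ | _ | _) <;> try simp [hpq.symm]
    by_cases hu : u = p
    · simp [hu]
    · by_cases hu' : u = q <;> simp [hu, hu', hpq.symm]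
  right_inv := by
    rintro ((((u | _) | _) | _ | _) | _ | _) <;> try simp [hpq.symm]
    by_cases hu : u = p
    · simp [hu]
    · by_cases hu' : u = q <;> simp [hu, hu', hpq.symm]

/-- A site has no edges at `h` besides `ev` and `ew`, and both stay there. The third leg of the new
X spider is the new edge `some true`. -/
theorem inl_h_mem_oldEnds_iff (e : D.E) : .inl S.h ∈ S.oldEnds e ↔ e = S.ev ∨ e = S.ew := by
  rcases S.edge_cases e with rfl | rfl | rfl | rfl | ⟨h₁, h₂, h₃, h₄⟩
  · simp [S.oldEnds_ev]
  · simp [S.oldEnds_ew]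
  · simp [S.oldEnds_ox, S.x_ne_h.symm, S.ev_ne_ox.symm, S.ew_ne_ox.symm]
  · simp [S.oldEnds_oy, S.y_ne_h.symm, S.ev_ne_oy.symm, S.ew_ne_oy.symm]
  · simp only [S.oldEnds_of_ne h₁ h₂ h₃ h₄, Sym2.mem_map, Sum.inl.injEq, exists_eq_right, h₁, h₂,
      or_self, iff_false]
    exact fun h => (S.eq_or_eq e h).elim h₁ h₂

/-- The legs of the vertex `h` in `S.pullOut`. -/
def leg : Option Bool → D.E ⊕ Option Bool
  | none => .inl S.ev
  | some false => .inl S.ew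
  | some true => .inr (some true)

theorem leg_injective : Function.Injective S.leg := by
  rintro (_ | _ | _) (_ | _ | _) h <;> simp_all [leg, S.ev_ne_ew, S.ev_ne_ew.symm]

theorem h_mem_pullOut_ends_iff (e : D.E ⊕ Option Bool) :
    (Sum.inl S.h : D.V ⊕ Option Bool) ∈ Sum.elim S.oldEnds S.newEnds e ↔ ∃ b, S.leg b = e := by
  rcases e with e | _ | _ | _
  · simp [S.inl_h_mem_oldEnds_iff, Option.exists, leg, eq_comm]
  · simp [newEnds, Option.exists, leg, S.v_ne_h.symm]
  · simp [newEnds, Option.exists, leg, S.w_ne_h.symm]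
  · simp [newEnds, Option.exists, leg]

/-- The legs of the vertex `h` in `S.pullOut`. -/
noncomputable def legEquiv : Option Bool ≃
    {e : D.E ⊕ Option Bool // (Sum.inl S.h : D.V ⊕ Option Bool) ∈ Sum.elim S.oldEnds S.newEnds e} :=
  Equiv.ofBijective (fun b => ⟨S.leg b, (S.h_mem_pullOut_ends_iff _).2 ⟨b, rfl⟩⟩)
    ⟨fun _ _ h => S.leg_injective (congrArg Subtype.val h), fun e => by
      obtain ⟨b, hb⟩ := (S.h_mem_pullOut_ends_iff e).1 e.2
      exact ⟨b, Subtype.ext hb⟩⟩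

/-- The vertices of `S.stage₄`, as vertices of the result of the colour change of `h` in
`S.pullOut`. -/
noncomputable def φ : S.pullOut.V ⊕ {e : S.pullOut.E // Sum.inl S.h ∈ S.pullOut.ends e} ≃ S.stage₄.V :=
  ((Equiv.refl _).sumCongr S.legEquiv.symm).trans (vertexEquiv S.h)

/-- The edges of `S.stage₄`, as edges of the result of the colour change of `h` in `S.pullOut`. -/
noncomputable def ψ : S.pullOut.E ⊕ {e : S.pullOut.E // Sum.inl S.h ∈ S.pullOut.ends e} ≃ S.stage₄.E :=
  ((Equiv.refl _).sumCongr S.legEquiv.symm).trans (edgeEquiv S.ew S.oy S.ew_ne_oy)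

theorem φ_inr (b : Option Bool) : S.φ (.inr (S.legEquiv b)) = vertexEquiv S.h (.inr b) := by
  change vertexEquiv S.h (.inr (S.legEquiv.symm (S.legEquiv b))) = _
  rw [Equiv.symm_apply_apply]

theorem ψ_inr (b : Option Bool) :
    S.ψ (.inr (S.legEquiv b)) = edgeEquiv S.ew S.oy S.ew_ne_oy (.inr b) := by
  change edgeEquiv S.ew S.oy S.ew_ne_oy (.inr (S.legEquiv.symm (S.legEquiv b))) = _
  rw [Equiv.symm_apply_apply]

theorem φ_inl_h : S.φ (.inl (.inl S.h)) = .inl (.inl (.inr ())) := if_pos rfl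

theorem φ_inl_inl {u : D.V} (hu : u ≠ S.h) :
    S.φ (.inl (.inl u)) = .inl (.inl (.inl (.inl u))) := if_neg hu

theorem ψ_inl_ew : S.ψ (.inl (.inl S.ew)) = .inl (.inr false) := if_pos rfl

theorem ψ_inl_oy : S.ψ (.inl (.inl S.oy)) = .inr true :=
  (if_neg S.ew_ne_oy.symm).trans (if_pos rfl)

theorem ψ_inl_inl {e : D.E} (h₁ : e ≠ S.ew) (h₂ : e ≠ S.oy) :
    S.ψ (.inl (.inl e)) = .inl (.inl (.inl (.inl e))) :=
  (if_neg h₁).trans (if_neg h₂)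

theorem pullOut_ends_inl (e : D.E) : S.pullOut.ends (.inl e) = S.oldEnds e := rfl

/-- In `S.stage₄` the Z spider split off from `w` has exactly three legs, each leading to a Hadamard
vertex: the original `h`, and the nearer member of each inserted pair. This is the colour change of
the three-legged X spider of `S.pullOut`. So the X spider corresponds to the split-off spider, while
the original `h` becomes the Hadamard vertex on the leg `ev`. -/
theorem colourChangeRule_stage₄ : ColourChangeRule S.pullOut S.stage₄ := by
  refine ⟨.X, 0, .inl S.h, S.φ, S.ψ, if_pos rfl, ?_, ?_, ?_, ?_, ?_, ?_, ?_⟩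
  · rintro (e | f) h
    · exact S.not_isDiag_oldEnds e (by rw [← pullOut_ends_inl, h]; exact rfl)
    · exact S.not_isDiag_newEnds f (by rw [show S.newEnds f = _ from h]; exact rfl)
  · rw [S.φ_inl_h]
    rfl
  · rintro (u | _ | _ | _) hu
    · have hu' : u ≠ S.h := fun h => hu (by rw [h])
      rw [S.φ_inl_inl hu']
      exact (if_neg hu').symm
    all_goals rfl
  · intro e
    obtain ⟨b, rfl⟩ := S.legEquiv.surjective e
    rw [S.φ_inr]
    rcases b with _ | _ | _
    · exact S.kind_h
    all_goals rfl
  · intro e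
    obtain ⟨b, rfl⟩ := S.legEquiv.surjective e
    rw [S.φ_inr, S.ψ_inr, S.φ_inl_h]
    rcases b with _ | _ | _
    · exact S.stage₄_ends_ew
    · exact S.stage₄_ends_true.trans Sym2.eq_swap
    · exact S.stage₄_ends_oy
  · intro e w hw
    obtain ⟨b, rfl⟩ := S.legEquiv.surjective e
    rw [S.φ_inr]
    rcases b with _ | _ | _
    · change S.oldEnds S.ev = _ at hw
      rw [oldEnds_ev, Sym2.eq_swap] at hw
      obtain rfl := Sym2.congr_right.1 hw
      change S.stage₄.ends (S.ψ (.inl (.inl S.ev))) = _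
      rw [S.ψ_inl_inl S.ev_ne_ew S.ev_ne_oy, stage₄_ends_ev]
      exact Sym2.eq_swap
    · change S.oldEnds S.ew = _ at hw
      rw [oldEnds_ew] at hw
      obtain rfl := Sym2.congr_right.1 hw
      change S.stage₄.ends (S.ψ (.inl (.inl S.ew))) = _
      rw [S.ψ_inl_ew]
      exact S.stage₄_ends_false.trans Sym2.eq_swap
    · change S.newEnds (some true) = _ at hw
      obtain rfl := Sym2.congr_right.1 hw
      rfl
  · rintro (e | _ | _ | _) he
    · replace he := (S.inl_h_mem_oldEnds_iff e).not.1 he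
      push Not at he
      rw [pullOut_ends_inl]
      rcases S.edge_cases e with rfl | rfl | rfl | rfl | ⟨h₁, h₂, h₃, h₄⟩
      · exact (he.1 rfl).elim
      · exact (he.2 rfl).elim
      · rw [S.ψ_inl_inl S.ew_ne_ox.symm S.ox_ne_oy, stage₄_ends_ox, oldEnds_ox]
        exact congrArg (s(Sum.inl (Sum.inl (Sum.inl (Sum.inr ()))), ·)) (S.φ_inl_inl S.x_ne_h).symm
      · rw [S.ψ_inl_oy, oldEnds_oy]
        exact congrArg (s(Sum.inr true, ·)) (S.φ_inl_inl S.y_ne_h).symm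
      · rw [S.ψ_inl_inl h₂ h₄, oldEnds_of_ne S h₁ h₂ h₃ h₄]
        have hh : S.h ∉ D.ends e := fun h => (S.eq_or_eq e h).elim h₁ h₂
        generalize hab : D.ends e = p at hh
        induction p with
        | h a b =>
          simp only [Sym2.mem_iff, not_or] at hh
          rw [S.stage₄_ends_of_ne h₁ h₂ h₃ h₄ hab]
          exact (congrArg₂ (s(·, ·)) (S.φ_inl_inl (Ne.symm hh.1)) (S.φ_inl_inl (Ne.symm hh.2))).symm
    · refine S.stage₄_ends_v.trans ?_
      exact congrArg (s(·, Sum.inl (Sum.inl (Sum.inl (Sum.inr ()))))) (S.φ_inl_inl S.v_ne_h).symm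
    · refine S.stage₄_ends_w.trans ?_
      exact congrArg (s(·, Sum.inl (Sum.inr false))) (S.φ_inl_inl S.w_ne_h).symm
    · exact (he (Sym2.mem_mk_left _ _)).elim

theorem equivalent_pullOut : D.Equivalent S.pullOut :=
  .trans _ _ _ S.equivalent_stage₄ (.symm _ _ (.rel _ _ (.colourChange S.colourChangeRule_stage₄)))

end Site

end ZX.Diagram

namespace ZX.Diagram

variable {m n : ℕ}

/-! ### Layouts -/

/-- A layout of a diagram: a family of disjoint paths to the outputs, given by the successor function
`next`, that covers all vertices except for a set `pending` of Hadamard vertices, together with a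
`time` at each vertex.  Time increases along the paths; the other edges join a `Z` spider and an `X`
spider of the same time, or a `Z` spider and a pending vertex whose time lies between those of the
spider and of its successor. -/
structure Layout (D : Diagram m n) where
  pending : Set D.V
  next : D.V → Option D.V
  time : D.V → ℝ
  simple : D.IsSimple
  kind_of_mem : ∀ h ∈ pending, D.kind h = .hadamard
  next_of_mem : ∀ h ∈ pending, next h = none
  next_notMem : ∀ x y, next x = some y → y ∉ pending
  exists_edge : ∀ x y, next x = some y → ∃ e, D.ends e = s(x, y)
  next_injective : ∀ x y z, next x = some z → next y = some z → x = y
  exists_output : ∀ x, x ∉ pending → next x = none → ∃ j, D.kind x = .output j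
  time_lt : ∀ x y, next x = some y → time x < time y
  ends_eq : ∀ e, ∃ x y, D.ends e = s(x, y) ∧ (next x = some y ∨
    (∃ α β, D.kind x = .spider .Z α ∧ D.kind y = .spider .X β ∧ time x = time y) ∨
    (y ∈ pending ∧ (∃ α, D.kind x = .spider .Z α) ∧ time x < time y ∧
      ∀ z, next x = some z → time y < time z))
  injOn_time : pending.InjOn time

namespace Layout

variable {D : Diagram m n}

/-- A pending vertex lies on no wire and is not a spider, so only the third alternative of `ends_eq`
can hold for an edge at it. The neighbouring spider has a successor because a wire can stop only at
an output. -/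
theorem exists_spider (L : D.Layout) {h : D.V} (hh : h ∈ L.pending) {e : D.E} (he : h ∈ D.ends e) :
    ∃ v x o α, D.ends e = s(v, h) ∧ D.kind v = .spider .Z α ∧ L.time v < L.time h ∧
      L.next v = some x ∧ L.time h < L.time x ∧ D.ends o = s(v, x) := by
  obtain ⟨v, y, hvy, H⟩ := L.ends_eq e
  have hk := L.kind_of_mem h hh
  rw [hvy, Sym2.mem_iff] at he
  rcases H with H | ⟨α, β, hv, hy, -⟩ | ⟨hy, ⟨α, hv⟩, hlt, H⟩
  · rcases he with rfl | rfl
    · simp [L.next_of_mem _ hh] at H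
    · exact (L.next_notMem _ _ H hh).elim
  · rcases he with rfl | rfl <;> simp_all
  · obtain rfl : h = y := he.resolve_left (by rintro rfl; simp_all)
    cases hx : L.next v with
    | none =>
      obtain ⟨j, hj⟩ := L.exists_output v (fun h => by simp_all [L.kind_of_mem v h]) hx
      simp_all
    | some x =>
      obtain ⟨o, ho⟩ := L.exists_edge _ _ hx
      exact ⟨v, x, o, α, hvy, hv, hlt, hx, H x hx, ho⟩

/-- Degree two gives exactly two edges at `h`, and simplicity makes their other ends distinct. The
remaining inequalities of a site follow from times: `v` and `w` come before `h`, and `x` and `y`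
after it. -/
theorem exists_site (L : D.Layout) {h : D.V} (hh : h ∈ L.pending) :
    ∃ S : D.Site, S.h = h ∧ L.next S.v = some S.x ∧ L.next S.w = some S.y ∧
      L.time S.v < L.time h ∧ L.time h < L.time S.x ∧
      L.time S.w < L.time h ∧ L.time h < L.time S.y := by
  have hd := D.degree_hadamard h (L.kind_of_mem h hh)
  rw [degree_of_loopless L.simple.2, Set.ncard_eq_two] at hd
  obtain ⟨ev, ew, hne, hset⟩ := hd
  have hmem : ∀ e, h ∈ D.ends e ↔ e = ev ∨ e = ew := fun e => by
    simpa using Set.ext_iff.1 hset e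
  obtain ⟨v, x, ox, α, hev, hkv, hvh, hnv, hhx, hox⟩ := L.exists_spider hh ((hmem ev).2 (.inl rfl))
  obtain ⟨w, y, oy, β, hew, hkw, hwh, hnw, hhy, hoy⟩ := L.exists_spider hh ((hmem ew).2 (.inr rfl))
  refine ⟨⟨L.simple.2, h, v, w, x, y, ev, ew, ox, oy, α, β, L.kind_of_mem h hh, hkv, hkw, hev, hew,
    hox, hoy, fun e => (hmem e).1, ?_, ?_, ?_, ?_, ?_⟩, rfl, hnv, hnw, hvh, hhx, hwh, hhy⟩
  · rintro rfl
    exact hne (L.simple.1 (hev.trans hew.symm))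
  · rintro rfl
    exact lt_irrefl _ hhx
  · rintro rfl
    exact lt_irrefl _ hhy
  · rintro rfl
    exact lt_asymm hhx hwh
  · rintro rfl
    exact lt_asymm hhy hvh

end Layout

/-! ### The layout after pulling out a controlled phase -/

namespace Site

variable {D : Diagram m n} (S : D.Site)

/-- Every new or redirected edge has a new vertex as an end, so it cannot be parallel to an
untouched edge. At each new vertex the other ends are distinct: `v`, `h`, `x` at the Z spider, and
`w`, `h` or `h`, `y` at the Hadamard vertices. -/
theorem pullOut_isSimple (hD : D.IsSimple) : S.pullOut.IsSimple := by
  refine ⟨?_, by rintro (e | f); exacts [S.not_isDiag_oldEnds e, S.not_isDiag_newEnds f]⟩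
  have hev := S.oldEnds_ev
  have hew := S.oldEnds_ew
  have hox := S.oldEnds_ox
  have hoy := S.oldEnds_oy
  have hold : ∀ e, (e = S.ev ∨ e = S.ew ∨ e = S.ox ∨ e = S.oy) ∨
      ∃ a b, D.ends e = s(a, b) ∧ S.oldEnds e = s(.inl a, .inl b) := by
    intro e
    rcases S.edge_cases e with h | h | h | h | ⟨h₁, h₂, h₃, h₄⟩
    · exact .inl (.inl h)
    · exact .inl (.inr (.inl h))
    · exact .inl (.inr (.inr (.inl h)))
    · exact .inl (.inr (.inr (.inr h)))
    · obtain ⟨⟨a, b⟩, hab⟩ := Quot.exists_rep (D.ends e)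
      exact .inr ⟨a, b, hab.symm, by rw [S.oldEnds_of_ne h₁ h₂ h₃ h₄, ← hab]; rfl⟩
  have h₀ : Function.Injective S.oldEnds := by
    intro e e' h
    rcases hold e with (rfl | rfl | rfl | rfl) | ⟨a, b, hab, he⟩ <;>
    rcases hold e' with (rfl | rfl | rfl | rfl) | ⟨a', b', hab', he'⟩ <;>
    simp_all [S.x_ne_h, S.y_ne_h, S.x_ne_h.symm, S.y_ne_h.symm]
    · exact hD.1 (by rw [hab, hab']; simpa using h)
  have h₁ : ∀ e f, S.oldEnds e ≠ S.newEnds f := by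
    intro e f h
    rcases hold e with (rfl | rfl | rfl | rfl) | ⟨a, b, hab, he⟩ <;> rcases f with _ | _ | _ <;>
      simp_all [newEnds, S.v_ne_h, S.w_ne_h, S.v_ne_x, S.w_ne_y, S.y_ne_h.symm]
  rintro (e | f) (e' | f') h
  · exact congrArg _ (h₀ h)
  · exact (h₁ e f' h).elim
  · exact (h₁ e' f h.symm).elim
  · replace h : S.newEnds f = S.newEnds f' := h
    rcases f with _ | _ | _ <;> rcases f' with _ | _ | _ <;> first | rfl | simp [newEnds] at h

open Classical in
/-- The successors in `S.pullOut`. -/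
noncomputable def pullNext (next : D.V → Option D.V) : D.V ⊕ Option Bool → Option (D.V ⊕ Option Bool)
  | .inl u =>
    if u = S.v then some (.inr none) else if u = S.w then some (.inr (some false))
    else if u = S.h then some (.inr (some true)) else (next u).map .inl
  | .inr none => some (.inl S.x)
  | .inr (some false) => some (.inl S.h)
  | .inr (some true) => some (.inl S.y)

theorem pullNext_v (next : D.V → Option D.V) : S.pullNext next (.inl S.v) = some (.inr none) :=
  if_pos rfl

theorem pullNext_w (next : D.V → Option D.V) :
    S.pullNext next (.inl S.w) = some (.inr (some false)) := by
  simp [pullNext, S.v_ne_w.symm]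

theorem pullNext_h (next : D.V → Option D.V) :
    S.pullNext next (.inl S.h) = some (.inr (some true)) := by
  simp [pullNext, S.v_ne_h.symm, S.w_ne_h.symm]

theorem pullNext_of_ne (next : D.V → Option D.V) {u : D.V} (h₁ : u ≠ S.v) (h₂ : u ≠ S.w)
    (h₃ : u ≠ S.h) : S.pullNext next (.inl u) = (next u).map .inl := by
  simp [pullNext, h₁, h₂, h₃]

theorem vertex_cases (u : D.V) : u = S.v ∨ u = S.w ∨ u = S.h ∨ (u ≠ S.v ∧ u ≠ S.w ∧ u ≠ S.h) := by
  tauto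

theorem pullNext_cases {next : D.V → Option D.V} {a b : D.V ⊕ Option Bool}
    (h : S.pullNext next a = some b) :
    (a = .inl S.v ∧ b = .inr none) ∨ (a = .inl S.w ∧ b = .inr (some false)) ∨
    (a = .inl S.h ∧ b = .inr (some true)) ∨ (a = .inr none ∧ b = .inl S.x) ∨
    (a = .inr (some false) ∧ b = .inl S.h) ∨ (a = .inr (some true) ∧ b = .inl S.y) ∨
    ∃ u u', u ≠ S.v ∧ u ≠ S.w ∧ u ≠ S.h ∧ a = .inl u ∧ b = .inl u' ∧ next u = some u' := by
  rcases a with u | _ | _ | _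
  · rcases S.vertex_cases u with rfl | rfl | rfl | ⟨h₁, h₂, h₃⟩
    · simp_all [S.pullNext_v]
    · simp_all [S.pullNext_w]
    · simp_all [S.pullNext_h]
    · rw [S.pullNext_of_ne next h₁ h₂ h₃, Option.map_eq_some_iff] at h
      obtain ⟨u', hu', rfl⟩ := h
      simp [h₁, h₂, h₃, hu']
  all_goals simp_all [pullNext]

/-- The times of the vertices of `S.pullOut`. -/
def pullTime (time : D.V → ℝ) (r s : ℝ) : D.V ⊕ Option Bool → ℝ
  | .inl u => time u
  | .inr none => time S.h
  | .inr (some false) => r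
  | .inr (some true) => s

/-- The layout of `S.pullOut`. -/
noncomputable def pullLayout (L : D.Layout) (hh : S.h ∈ L.pending) (hv : L.next S.v = some S.x)
    (hw : L.next S.w = some S.y) (r s : ℝ) (hvh : L.time S.v < L.time S.h)
    (hhx : L.time S.h < L.time S.x) (hwr : L.time S.w < r) (hrh : r < L.time S.h)
    (hhs : L.time S.h < s) (hsy : s < L.time S.y)
    (hr : ∀ u ∈ L.pending, u ≠ S.h → L.time u < r) : S.pullOut.Layout where
  pending := {a | ∃ u ∈ L.pending, u ≠ S.h ∧ a = .inl u}
  next := S.pullNext L.next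
  time := S.pullTime L.time r s
  simple := S.pullOut_isSimple L.simple
  kind_of_mem := by
    rintro _ ⟨u, hu, huh, rfl⟩
    exact (if_neg huh).trans (L.kind_of_mem u hu)
  next_of_mem := by
    rintro _ ⟨u, hu, huh, rfl⟩
    have h₁ : u ≠ S.v := by rintro rfl; simp [L.next_of_mem _ hu] at hv
    have h₂ : u ≠ S.w := by rintro rfl; simp [L.next_of_mem _ hu] at hw
    exact (S.pullNext_of_ne L.next h₁ h₂ huh).trans (by rw [L.next_of_mem u hu]; rfl)
  next_notMem := by
    rintro a _ ha ⟨u, hu, huh, rfl⟩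
    rcases S.pullNext_cases ha with ⟨-, h⟩ | ⟨-, h⟩ | ⟨-, h⟩ | ⟨-, h⟩ | ⟨-, h⟩ | ⟨-, h⟩ |
      ⟨w, u', -, -, -, -, h, hw⟩ <;> simp only [Sum.inl.injEq, reduceCtorEq] at h <;> subst h
    · exact L.next_notMem _ _ hv hu
    · exact huh rfl
    · exact L.next_notMem _ _ hw hu
    · exact L.next_notMem _ _ hw hu
  exists_edge := by
    intro a b h
    rcases S.pullNext_cases h with ⟨rfl, rfl⟩ | ⟨rfl, rfl⟩ | ⟨rfl, rfl⟩ | ⟨rfl, rfl⟩ | ⟨rfl, rfl⟩ |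
      ⟨rfl, rfl⟩ | ⟨u, u', h₁, h₂, h₃, rfl, rfl, hu⟩
    · exact ⟨.inr none, rfl⟩
    · exact ⟨.inr (some false), rfl⟩
    · exact ⟨.inr (some true), rfl⟩
    · exact ⟨.inl S.ox, S.oldEnds_ox⟩
    · exact ⟨.inl S.ew, S.oldEnds_ew.trans Sym2.eq_swap⟩
    · exact ⟨.inl S.oy, S.oldEnds_oy⟩
    · obtain ⟨e, he⟩ := L.exists_edge _ _ hu
      refine ⟨.inl e, (S.oldEnds_of_ne ?_ ?_ ?_ ?_).trans (by rw [he]; rfl)⟩ <;> rintro rfl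
      · rw [S.ends_ev] at he
        rcases Sym2.eq_iff.1 he with ⟨rfl, -⟩ | ⟨-, rfl⟩
        exacts [h₁ rfl, h₃ rfl]
      · rw [S.ends_ew] at he
        rcases Sym2.eq_iff.1 he with ⟨rfl, -⟩ | ⟨-, rfl⟩
        exacts [h₂ rfl, h₃ rfl]
      -- As `u` is not `v`, the wire edge could coincide with `ox` only in the reverse direction,
      -- from `x` to `v`. This contradicts the growth of time.
      · rw [S.ends_ox] at he
        rcases Sym2.eq_iff.1 he with ⟨rfl, -⟩ | ⟨rfl, rfl⟩
        exacts [h₁ rfl, lt_asymm (L.time_lt _ _ hv) (L.time_lt _ _ hu)]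
      · rw [S.ends_oy] at he
        rcases Sym2.eq_iff.1 he with ⟨rfl, -⟩ | ⟨rfl, rfl⟩
        exacts [h₂ rfl, lt_asymm (L.time_lt _ _ hw) (L.time_lt _ _ hu)]
  next_injective := by
    have hxy : S.x ≠ S.y := fun h => S.v_ne_w (L.next_injective _ _ _ hv (h ▸ hw))
    have hx : ∀ u, u ≠ S.v → L.next u ≠ some S.x := fun u hu h => hu (L.next_injective _ _ _ h hv)
    have hy : ∀ u, u ≠ S.w → L.next u ≠ some S.y := fun u hu h => hu (L.next_injective _ _ _ h hw)
    have hp : ∀ u, L.next u ≠ some S.h := fun u h => L.next_notMem _ _ h hh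
    intro a b c ha hb
    rcases S.pullNext_cases ha with ⟨rfl, rfl⟩ | ⟨rfl, rfl⟩ | ⟨rfl, rfl⟩ | ⟨rfl, rfl⟩ | ⟨rfl, rfl⟩ |
      ⟨rfl, rfl⟩ | ⟨u, u', h₁, h₂, h₃, rfl, rfl, hu⟩ <;>
    rcases S.pullNext_cases hb with ⟨rfl, h⟩ | ⟨rfl, h⟩ | ⟨rfl, h⟩ | ⟨rfl, h⟩ | ⟨rfl, h⟩ |
      ⟨rfl, h⟩ | ⟨w, w', h₁', h₂', h₃', rfl, h, hw⟩ <;>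
    simp only [Sum.inl.injEq, Sum.inr.injEq, reduceCtorEq, Option.some.injEq] at h <;>
    first
    | rfl
    | (subst h; exact congrArg _ (L.next_injective _ _ _ hu hw))
    | simp_all
  exists_output := by
    rintro (u | _ | _ | _) hu h
    · rcases S.vertex_cases u with rfl | rfl | rfl | ⟨h₁, h₂, h₃⟩
      · simp [S.pullNext_v] at h
      · simp [S.pullNext_w] at h
      · simp [S.pullNext_h] at h
      · replace h := Option.map_eq_none_iff.1 ((S.pullNext_of_ne L.next h₁ h₂ h₃).symm.trans h)
        obtain ⟨j, hj⟩ := L.exists_output u (fun hu' => hu ⟨u, hu', h₃, rfl⟩) h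
        exact ⟨j, (if_neg h₃).trans hj⟩
    all_goals simp [pullNext] at h
  time_lt := by
    intro a b h
    rcases S.pullNext_cases h with ⟨rfl, rfl⟩ | ⟨rfl, rfl⟩ | ⟨rfl, rfl⟩ | ⟨rfl, rfl⟩ | ⟨rfl, rfl⟩ |
      ⟨rfl, rfl⟩ | ⟨u, u', h₁, h₂, h₃, rfl, rfl, hu⟩
    exacts [hvh, hwr, hhs, hhx, hrh, hsy, L.time_lt _ _ hu]
  ends_eq := by
    rintro (e | _ | _ | _)
    · rcases S.edge_cases e with rfl | rfl | rfl | rfl | ⟨h₁, h₂, h₃, h₄⟩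
      · exact ⟨.inr none, .inl S.h, S.oldEnds_ev, .inr (.inl ⟨0, 0, rfl, if_pos rfl, rfl⟩)⟩
      · exact ⟨.inr (some false), .inl S.h, S.oldEnds_ew.trans Sym2.eq_swap, .inl rfl⟩
      · exact ⟨.inr none, .inl S.x, S.oldEnds_ox, .inl rfl⟩
      · exact ⟨.inr (some true), .inl S.y, S.oldEnds_oy, .inl rfl⟩
      · obtain ⟨a, b, hab, H⟩ := L.ends_eq e
        have hmem : S.h ∉ D.ends e := fun h => (S.eq_or_eq e h).elim h₁ h₂
        rw [hab, Sym2.mem_iff, not_or] at hmem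
        refine ⟨.inl a, .inl b, (S.oldEnds_of_ne h₁ h₂ h₃ h₄).trans (by rw [hab]; rfl), ?_⟩
        rcases H with H | ⟨α, β, ha, hb, hlt⟩ | ⟨hb, ⟨α, ha⟩, hlt, H⟩
        · refine .inl ((S.pullNext_of_ne L.next ?_ ?_ (Ne.symm hmem.1)).trans (by rw [H]; rfl))
          · rintro rfl
            rw [hv, Option.some_inj] at H
            exact h₃ (L.simple.1 (by rw [hab, S.ends_ox, H]))
          · rintro rfl
            rw [hw, Option.some_inj] at H
            exact h₄ (L.simple.1 (by rw [hab, S.ends_oy, H]))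
        · exact .inr (.inl ⟨α, β, (if_neg (Ne.symm hmem.1)).trans ha,
            (if_neg (Ne.symm hmem.2)).trans hb, hlt⟩)
        -- Here it matters that `h` is the latest pending vertex: the new successors of `v` and `w`
        -- have times `L.time S.h` and `r`, and by `hr` every other pending vertex comes before
        -- both.
        · have hbr := hr b hb (Ne.symm hmem.2)
          refine .inr (.inr ⟨⟨b, hb, Ne.symm hmem.2, rfl⟩, ⟨α, (if_neg (Ne.symm hmem.1)).trans ha⟩,
            hlt, fun z hz => ?_⟩)
          rcases S.pullNext_cases hz with ⟨-, rfl⟩ | ⟨-, rfl⟩ | ⟨h, rfl⟩ | ⟨h, rfl⟩ | ⟨h, rfl⟩ |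
            ⟨h, rfl⟩ | ⟨u, u', -, -, -, h, rfl, hu⟩
          · exact hbr.trans hrh
          · exact hbr
          · exact (hmem.1 (Sum.inl_injective h).symm).elim
          · cases h
          · cases h
          · cases h
          · obtain rfl := Sum.inl_injective h
            exact H _ hu
    · exact ⟨.inl S.v, .inr none, rfl, .inl (S.pullNext_v _)⟩
    · exact ⟨.inl S.w, .inr (some false), rfl, .inl (S.pullNext_w _)⟩
    · exact ⟨.inl S.h, .inr (some true), rfl, .inl (S.pullNext_h _)⟩
  injOn_time := by
    rintro _ ⟨u, hu, huh, rfl⟩ _ ⟨u', hu', huh', rfl⟩ h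
    rw [L.injOn_time hu hu' h]

end Site

/-! ### Eliminating the pending vertices -/

namespace Layout

theorem exists_equivalent_pending_eq_empty (k : ℕ) (D : Diagram m n) (L : D.Layout)
    (hk : L.pending.ncard = k) : ∃ D' : Diagram m n, D.Equivalent D' ∧ ∃ L' : D'.Layout,
      L'.pending = ∅ := by
  have hfin (D : Diagram m n) (s : Set D.V) : s.Finite := by
    have := D.finite_V
    exact s.toFinite
  induction k generalizing D with
  | zero => exact ⟨D, .refl _, L, (Set.ncard_eq_zero (hfin D _)).1 hk⟩
  | succ k ih =>
    have hne : L.pending.Nonempty := by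
      rw [← Set.ncard_pos (hfin D _)]
      omega
    -- The latest pending vertex is treated first. Pending times are distinct, so the others are
    -- strictly earlier.
    obtain ⟨h, hh, hmax⟩ := (hfin D L.pending).exists_maximalFor L.time _ hne
    obtain ⟨S, rfl, hv, hw, hvh, hhx, hwh, hhy⟩ := L.exists_site hh
    have hlt : ∀ u ∈ L.pending, u ≠ S.h → L.time u < L.time S.h := fun u hu huh =>
      lt_of_le_of_ne (le_of_not_gt fun h => h.not_ge (hmax hu h.le))
        fun h => huh (L.injOn_time hu hh h)
    -- The Hadamard vertex in front of the X spider needs a time `r` after `w` and after all other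
    -- pending vertices, yet before `h`. These are finitely many constraints in a dense order. The
    -- one behind it needs only a time between those of `h` and `y`.
    obtain ⟨r, hr, hrh⟩ := Order.exists_between_finsets
      (((hfin D (insert S.w (L.pending \ {S.h}))).image L.time).toFinset) {L.time S.h} (by
        simp only [Set.Finite.mem_toFinset, Finset.mem_singleton]
        rintro _ ⟨u, rfl | ⟨hu, huh⟩, rfl⟩ _ rfl
        exacts [hwh, hlt u hu huh])
    simp only [Set.Finite.mem_toFinset, Finset.mem_singleton, forall_eq] at hr hrh
    obtain ⟨s, hhs, hsy⟩ := exists_between hhy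
    obtain ⟨D', hD', hL'⟩ := ih S.pullOut (S.pullLayout L hh hv hw r s hvh hhx
      (hr _ ⟨_, .inl rfl, rfl⟩) hrh hhs hsy fun u hu huh => hr _ ⟨u, .inr ⟨hu, huh⟩, rfl⟩) (by
        change {a | ∃ u ∈ L.pending, u ≠ S.h ∧ a = Sum.inl u}.ncard = k
        have : {a : D.V ⊕ Option Bool | ∃ u ∈ L.pending, u ≠ S.h ∧ a = Sum.inl u} =
            Sum.inl '' (L.pending \ {S.h}) := by
          ext a
          simp [and_assoc, eq_comm]
        rw [this, Set.ncard_image_of_injective _ Sum.inl_injective,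
          Set.ncard_sdiff_singleton_of_mem hh, hk]
        rfl)
    exact ⟨D', .trans _ _ _ S.equivalent_pullOut hD', hL'⟩

end Layout

end ZX.Diagram

namespace ZX

/-- Between two spiders of one colour the other colour serves; between two Hadamard vertices any
colour does. -/
theorem Kind.SameType.exists_colour {m n : ℕ} {k k' : Kind m n} (h : k.SameType k') :
    ∃ c, ¬ k.SameType (.spider c 0) ∧ ¬ (Kind.spider c 0).SameType k' := by
  rcases k with _ | _ | ⟨c, α⟩ | _ <;> rcases k' with _ | _ | ⟨c', α'⟩ | _ <;>
    simp only [Kind.SameType] at h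
  · subst h
    cases c
    · exact ⟨.X, by simp [Kind.SameType], by simp [Kind.SameType]⟩
    · exact ⟨.Z, by simp [Kind.SameType], by simp [Kind.SameType]⟩
  · exact ⟨.Z, by simp [Kind.SameType], by simp [Kind.SameType]⟩

theorem Kind.SameType.symm {m n : ℕ} {k k' : Kind m n} (h : k.SameType k') : k'.SameType k := by
  rcases k with _ | _ | _ | _ <;> rcases k' with _ | _ | _ | _ <;>
    simp_all [Kind.SameType]

namespace Diagram

variable {m n : ℕ}

/-! ### Three-colouring -/

/-- The edges that join two vertices of the same type. -/
def badEdges (D : Diagram m n) : Set D.E :=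
  {e | ∃ x y, D.ends e = s(x, y) ∧ (D.kind x).SameType (D.kind y)}

theorem isThreeColoured_of_badEdges_eq_empty {D : Diagram m n} (h : D.badEdges = ∅) :
    D.IsThreeColoured := by
  rintro u v ⟨-, e, he⟩ hk
  exact (Set.eq_empty_iff_forall_notMem.1 h e) ⟨u, v, he, hk⟩

theorem insertSpider_ends_self (D : Diagram m n) (hD : D.Loopless) (c : Colour) (e₀ : D.E) (x y : D.V)
    (h₀ : D.ends e₀ = s(x, y)) :
    (D.insertSpider hD c e₀ x y h₀).ends (.inl e₀) = s(.inl x, .inr ()) := if_pos rfl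

theorem insertSpider_ends_of_ne (D : Diagram m n) (hD : D.Loopless) (c : Colour) (e₀ : D.E)
    (x y : D.V) (h₀ : D.ends e₀ = s(x, y)) {e : D.E} (he : e ≠ e₀) :
    (D.insertSpider hD c e₀ x y h₀).ends (.inl e) = (D.ends e).map Sum.inl := if_neg he

theorem insertSpider_isSimple (D : Diagram m n) (hD : D.IsSimple) (c : Colour) (e₀ : D.E) (x y : D.V)
    (h₀ : D.ends e₀ = s(x, y)) : (D.insertSpider hD.2 c e₀ x y h₀).IsSimple := by
  classical
  have hxy : x ≠ y := by
    rintro rfl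
    exact hD.2 e₀ (by rw [h₀]; exact rfl)
  have hne : ∀ (s : Sym2 D.V) (a : D.V), (s.map Sum.inl : Sym2 (D.V ⊕ Unit)) ≠ s(.inl a, .inr ()) := by
    intro s a h
    have : (.inr () : D.V ⊕ Unit) ∈ s.map Sum.inl := by rw [h]; simp
    simp at this
  have hself := D.insertSpider_ends_self hD.2 c e₀ x y h₀
  constructor
  · rintro (e | ⟨⟩) (e' | ⟨⟩) h
    · by_cases he : e = e₀ <;> by_cases he' : e' = e₀
      · rw [he, he']
      · rw [he, hself, D.insertSpider_ends_of_ne hD.2 c e₀ x y h₀ he'] at h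
        exact (hne _ _ h.symm).elim
      · rw [he', hself, D.insertSpider_ends_of_ne hD.2 c e₀ x y h₀ he] at h
        exact (hne _ _ h).elim
      · rw [D.insertSpider_ends_of_ne hD.2 c e₀ x y h₀ he,
          D.insertSpider_ends_of_ne hD.2 c e₀ x y h₀ he'] at h
        rw [hD.1 (Sym2.map.injective Sum.inl_injective h)]
    · by_cases he : e = e₀
      · rw [he, hself] at h
        rcases Sym2.eq_iff.1 h with ⟨h, -⟩ | ⟨h, -⟩
        · cases h
        · exact (hxy (Sum.inl_injective h)).elim
      · rw [D.insertSpider_ends_of_ne hD.2 c e₀ x y h₀ he] at h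
        exact (hne _ _ (h.trans Sym2.eq_swap)).elim
    · by_cases he : e' = e₀
      · rw [he, hself] at h
        rcases Sym2.eq_iff.1 h with ⟨h, -⟩ | ⟨-, h⟩
        · cases h
        · exact (hxy (Sum.inl_injective h).symm).elim
      · rw [D.insertSpider_ends_of_ne hD.2 c e₀ x y h₀ he] at h
        exact (hne _ _ (h.symm.trans Sym2.eq_swap)).elim
    · rfl
  · rintro (e | ⟨⟩)
    · exact not_isDiag_subdivide hD.2 x () _ e
    · change ¬ (s(.inr (), .inl y) : Sym2 (D.V ⊕ Unit)).IsDiag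
      simp

namespace Layout

variable {D : Diagram m n}

open Classical in
/-- The successors after subdividing the path edge from `x` to `y`. -/
noncomputable def spiderNext {V : Type} (next : V → Option V) (x y : V) : V ⊕ Unit → Option (V ⊕ Unit)
  | .inl u => if u = x then some (.inr ()) else (next u).map .inl
  | .inr _ => some (.inl y)

theorem spiderNext_cases {V : Type} {next : V → Option V} {x y : V} {a b : V ⊕ Unit}
    (h : spiderNext next x y a = some b) : (a = .inl x ∧ b = .inr ()) ∨ (a = .inr () ∧ b = .inl y) ∨
      ∃ u u', u ≠ x ∧ a = .inl u ∧ b = .inl u' ∧ next u = some u' := by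
  rcases a with u | ⟨⟩
  · by_cases hu : u = x
    · simp_all [spiderNext]
    · simp only [spiderNext, if_neg hu, Option.map_eq_some_iff] at h
      obtain ⟨u', hu', rfl⟩ := h
      exact .inr (.inr ⟨u, u', hu, rfl, rfl, hu'⟩)
  · simp_all [spiderNext]

/-- The layout after subdividing a path edge by a spider. -/
noncomputable def insertSpider (L : D.Layout) (hL : L.pending = ∅) (c : Colour) (e₀ : D.E) (x y : D.V)
    (h₀ : D.ends e₀ = s(x, y)) (hxy : L.next x = some y) :
    (D.insertSpider L.simple.2 c e₀ x y h₀).Layout where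
  pending := ∅
  next := spiderNext L.next x y
  time := Sum.elim L.time fun _ => (L.time x + L.time y) / 2
  simple := D.insertSpider_isSimple L.simple c e₀ x y h₀
  kind_of_mem := fun _ h => h.elim
  next_of_mem := fun _ h => h.elim
  next_notMem := fun _ _ _ h => h.elim
  exists_edge := by
    intro a b h
    rcases spiderNext_cases h with ⟨rfl, rfl⟩ | ⟨rfl, rfl⟩ | ⟨u, u', hu, rfl, rfl, huu'⟩
    · exact ⟨.inl e₀, insertSpider_ends_self ..⟩
    · exact ⟨.inr (), rfl⟩
    · obtain ⟨e, he⟩ := L.exists_edge _ _ huu'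
      refine ⟨.inl e, (insertSpider_ends_of_ne _ _ _ _ _ _ _ ?_).trans (by rw [he]; rfl)⟩
      rintro rfl
      rw [h₀] at he
      rcases Sym2.eq_iff.1 he with ⟨rfl, -⟩ | ⟨rfl, rfl⟩
      exacts [hu rfl, lt_asymm (L.time_lt _ _ hxy) (L.time_lt _ _ huu')]
  next_injective := by
    intro a b c ha hb
    rcases spiderNext_cases ha with ⟨rfl, rfl⟩ | ⟨rfl, rfl⟩ | ⟨u, u', hu, rfl, rfl, huu'⟩ <;>
    rcases spiderNext_cases hb with ⟨rfl, h⟩ | ⟨rfl, h⟩ | ⟨w, w', hw, rfl, h, hww'⟩ <;>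
    simp only [Sum.inl.injEq, reduceCtorEq] at h <;> first | rfl | subst h
    · exact (hw (L.next_injective _ _ _ hww' hxy)).elim
    · exact (hu (L.next_injective _ _ _ huu' hxy)).elim
    · exact congrArg _ (L.next_injective _ _ _ huu' hww')
  exists_output := by
    rintro (u | ⟨⟩) - h
    · by_cases hu : u = x
      · simp [spiderNext, hu] at h
      · exact L.exists_output u (by simp [hL]) (Option.map_eq_none_iff.1 ((if_neg hu).symm.trans h))
    · simp [spiderNext] at h
  time_lt := by
    have := L.time_lt _ _ hxy
    intro a b h
    rcases spiderNext_cases h with ⟨rfl, rfl⟩ | ⟨rfl, rfl⟩ | ⟨u, u', hu, rfl, rfl, huu'⟩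
    · simp only [Sum.elim_inl, Sum.elim_inr]
      linarith
    · simp only [Sum.elim_inl, Sum.elim_inr]
      linarith
    · exact L.time_lt _ _ huu'
  ends_eq := by
    rintro (e | ⟨⟩)
    · by_cases he : e = e₀
      · subst he
        exact ⟨.inl x, .inr (), insertSpider_ends_self .., .inl (if_pos rfl)⟩
      · obtain ⟨a, b, hab, H⟩ := L.ends_eq e
        refine ⟨.inl a, .inl b, (insertSpider_ends_of_ne _ _ _ _ _ _ _ he).trans (by rw [hab]; rfl), ?_⟩
        rcases H with H | H | H
        · refine .inl ((if_neg ?_).trans (by rw [H]; rfl))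
          rintro rfl
          rw [hxy, Option.some_inj] at H
          exact he (L.simple.1 (by rw [hab, h₀, H]))
        · exact .inr (.inl H)
        · simp [hL] at H
    · exact ⟨.inr (), .inl y, rfl, .inl rfl⟩
  injOn_time := fun _ h => h.elim

/-- With nothing pending, an edge off the wires joins a Z spider to an X spider, so it is never bad.
-/
theorem exists_next_of_mem_badEdges (L : D.Layout) (hL : L.pending = ∅) {e : D.E}
    (he : e ∈ D.badEdges) : ∃ x y, D.ends e = s(x, y) ∧ L.next x = some y ∧
      (D.kind x).SameType (D.kind y) := by
  obtain ⟨a, b, hab, hk⟩ := he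
  obtain ⟨x, y, hxy, H⟩ := L.ends_eq e
  have hk' : (D.kind x).SameType (D.kind y) := by
    rcases Sym2.eq_iff.1 (hab.symm.trans hxy) with ⟨rfl, rfl⟩ | ⟨rfl, rfl⟩
    exacts [hk, hk.symm]
  rcases H with H | ⟨α, β, hx, hy, -⟩ | ⟨H, -⟩
  · exact ⟨x, y, hxy, H, hk'⟩
  · simp [hx, hy, Kind.SameType] at hk'
  · simp [hL] at H

/-- Both halves of the subdivided edge are good by the choice of colour, and the other edges keep
the types of their ends. -/
theorem badEdges_insertSpider_subset (hD : D.Loopless) {c : Colour} {e₀ : D.E}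
    {x y : D.V} (h₀ : D.ends e₀ = s(x, y)) (hx : ¬ (D.kind x).SameType (.spider c 0))
    (hy : ¬ (Kind.spider c 0).SameType (D.kind y)) :
    (D.insertSpider hD c e₀ x y h₀).badEdges ⊆ Sum.inl '' (D.badEdges \ {e₀}) := by
  rintro (e | ⟨⟩) ⟨a, b, hab, hk⟩
  · by_cases he : e = e₀
    · subst he
      rw [insertSpider_ends_self] at hab
      rcases Sym2.eq_iff.1 hab with ⟨rfl, rfl⟩ | ⟨rfl, rfl⟩
      exacts [(hx hk).elim, (hx hk.symm).elim]
    · refine ⟨e, ⟨?_, he⟩, rfl⟩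
      rw [insertSpider_ends_of_ne _ _ _ _ _ _ _ he] at hab
      obtain ⟨⟨p, q⟩, hpq⟩ := Quot.exists_rep (D.ends e)
      rw [← hpq] at hab
      rcases Sym2.eq_iff.1 hab with ⟨rfl, rfl⟩ | ⟨rfl, rfl⟩
      exacts [⟨p, q, hpq.symm, hk⟩, ⟨p, q, hpq.symm, hk.symm⟩]
  · rcases Sym2.eq_iff.1 hab with ⟨rfl, rfl⟩ | ⟨rfl, rfl⟩
    exacts [(hy hk).elim, (hy hk.symm).elim]

/-- Induction on the number of bad edges: each is a wire edge, and subdividing it removes it from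
the set without adding another. -/
theorem exists_equivalent_isThreeColoured (k : ℕ) (D : Diagram m n) (L : D.Layout)
    (hL : L.pending = ∅) (hk : D.badEdges.ncard = k) : ∃ D' : Diagram m n, D.Equivalent D' ∧
      D'.IsThreeColoured ∧ ∃ L' : D'.Layout, L'.pending = ∅ := by
  induction k using Nat.strong_induction_on generalizing D with
  | h k ih =>
    have hfin : D.badEdges.Finite := by
      have := D.finite_E
      exact Set.toFinite _
    rcases D.badEdges.eq_empty_or_nonempty with h | ⟨e, he⟩
    · exact ⟨D, .refl _, isThreeColoured_of_badEdges_eq_empty h, L, hL⟩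
    · obtain ⟨x, y, hxy, hnext, hs⟩ := L.exists_next_of_mem_badEdges hL he
      obtain ⟨c, hx, hy⟩ := hs.exists_colour
      obtain ⟨D', hD', h'⟩ := ih _ (by
        rw [← hk, ← Set.ncard_sdiff_singleton_add_one he hfin, Nat.lt_succ_iff,
          ← Set.ncard_image_of_injective (D.badEdges \ {e}) (Sum.inl_injective (β := Unit))]
        exact Set.ncard_le_ncard (badEdges_insertSpider_subset L.simple.2 hxy hx hy)
          ((hfin.subset Set.sdiff_subset).image _)) _ (L.insertSpider hL c e x y hxy hnext) rfl rfl
      exact ⟨D', .trans _ _ _ (.rel _ _ (.identity (identityRule_insertSpider ..))) hD', h'⟩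

/-! ### Circuit-like diagrams from layouts -/

/-- Follow `next` until it stops; this terminates since time increases on a finite set. Describing
membership by reachability makes it possible to compare paths with different starting points. -/
theorem exists_path (L : D.Layout) (hL : L.pending = ∅) (v : D.V) : ∃ p : List D.V,
    p.head? = some v ∧ p.IsChain (fun x y => L.next x = some y) ∧
    (∃ w j, p.getLast? = some w ∧ D.kind w = .output j) ∧
    (∀ w, w ∈ p ↔ Relation.ReflTransGen (fun x y => L.next x = some y) v w) ∧
    ∀ x ∈ p, ∀ y, L.next x = some y → [x, y] <:+: p := by
  have := D.finite_V
  induction v using (Finite.wellFounded_of_trans_of_irrefl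
    (InvImage (· > ·) L.time)).induction with
  | h v ih =>
    cases h : L.next v with
    | none =>
      obtain ⟨j, hj⟩ := L.exists_output v (by simp [hL]) h
      refine ⟨[v], rfl, by simp, ⟨v, j, rfl, hj⟩, fun w => ?_, by simp [h]⟩
      rw [Relation.ReflTransGen.cases_head_iff]
      simp [h, eq_comm]
    | some u =>
      obtain ⟨p, hp, hc, ⟨w, j, hw, hj⟩, hmem, hstep⟩ := ih u (L.time_lt _ _ h)
      obtain ⟨p, rfl⟩ : ∃ p', p = u :: p' := List.head?_eq_some_iff.1 hp
      refine ⟨v :: u :: p, rfl, ?_, ⟨w, j, by simpa using hw, hj⟩, fun w => ?_, ?_⟩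
      · exact .cons_cons h hc
      · rw [Relation.ReflTransGen.cases_head_iff, List.mem_cons, hmem]
        simp [h, eq_comm]
      · rintro x hx y hxy
        rcases List.mem_cons.1 hx with rfl | hx
        · obtain rfl : u = y := by simpa [h] using hxy
          exact ⟨[], p, rfl⟩
        · exact (hstep x hx y hxy).trans (List.suffix_cons _ _).isInfix

/-- Injectivity of `next` lets both paths be traced back from `v` in step. Neither start has a
predecessor, so both traces stop together. This gives disjointness of the wires. -/
theorem eq_of_reflTransGen (L : D.Layout) {s t v : D.V} (hs : ∀ u, L.next u ≠ some s)
    (ht : ∀ u, L.next u ≠ some t)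
    (hsv : Relation.ReflTransGen (fun x y => L.next x = some y) s v)
    (htv : Relation.ReflTransGen (fun x y => L.next x = some y) t v) : s = t := by
  induction hsv generalizing t with
  | refl =>
    rcases htv.cases_tail with h | ⟨u, -, hu⟩
    · exact h
    · exact (hs u hu).elim
  | tail _ h ih =>
    rcases htv.cases_tail with rfl | ⟨u, htu, hu⟩
    · exact (ht _ h).elim
    · obtain rfl := L.next_injective _ _ _ h hu
      exact ih ht htu

theorem exists_start (L : D.Layout) (v : D.V) : ∃ s, (∀ u, L.next u ≠ some s) ∧
    Relation.ReflTransGen (fun x y => L.next x = some y) s v := by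
  have := D.finite_V
  induction v using (Finite.wellFounded_of_trans_of_irrefl
    (InvImage (· < ·) L.time)).induction with
  | h v ih =>
    by_cases h : ∃ u, L.next u = some v
    · obtain ⟨u, hu⟩ := h
      obtain ⟨s, hs, hsu⟩ := ih u (L.time_lt _ _ hu)
      exact ⟨s, hs, hsu.tail hu⟩
    · exact ⟨v, not_exists.1 h, .refl⟩

/-- Used for closed walks, where a single strict increase is absurd. -/
theorem time_le_of_walk (L : D.Layout) {u v : D.V} (γ : D.graph.Walk u v)
    (h : ∀ d ∈ γ.darts, L.time d.fst ≤ L.time d.snd) :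
    L.time u ≤ L.time v ∧ ∀ d ∈ γ.darts, L.time d.fst < L.time d.snd → L.time u < L.time v := by
  induction γ with
  | nil => simp
  | cons hadj γ ih =>
    simp only [SimpleGraph.Walk.darts_cons, List.mem_cons, forall_eq_or_imp] at h ⊢
    obtain ⟨h₁, h₂⟩ := ih h.2
    exact ⟨h.1.trans h₁, fun h' => h'.trans_le h₁, fun d hd h' => h.1.trans_lt (h₂ d hd h')⟩

theorem circuitLike (L : D.Layout) (hL : L.pending = ∅) (hc : D.IsThreeColoured) :
    D.CircuitLike := by
  refine ⟨?_, L.simple, hc⟩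
  choose path hhead hchain hout hmem hstep using L.exists_path hL
  have hlt : ∀ v, (path v).Pairwise fun x y => L.time x < L.time y := fun v =>
    List.isChain_iff_pairwise.1 ((hchain v).imp fun x y => L.time_lt x y)
  have hpath : ∀ s x y, PathStep (path s) x y → L.next x = some y := fun s x y h => by
    simpa using (hchain s).infix h
  -- One path for each vertex without a predecessor.
  refine ⟨path '' {s | ∀ u, L.next u ≠ some s}, ?_, ?_, ?_, ?_⟩
  · rintro _ ⟨s, -, rfl⟩
    refine ⟨(hchain s).imp fun x y h => ?_, (hlt s).imp fun h => ?_, hout s⟩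
    · refine ⟨?_, L.exists_edge _ _ h⟩
      rintro rfl
      exact lt_irrefl _ (L.time_lt _ _ h)
    · rintro rfl
      exact lt_irrefl _ h
  · rintro _ ⟨s, hs, rfl⟩ _ ⟨t, ht, rfl⟩ hne v hv hv'
    exact hne (congrArg path (L.eq_of_reflTransGen hs ht ((hmem _ _).1 hv) ((hmem _ _).1 hv')))
  · intro v
    obtain ⟨s, hs, hsv⟩ := L.exists_start v
    exact ⟨_, ⟨s, hs, rfl⟩, (hmem s v).2 hsv⟩
  · rintro v γ - ⟨_, ⟨s, -, rfl⟩, -, -, -, ⟨d, hd, hds⟩, -⟩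
    by_contra hcon
    push Not at hcon
    -- The paths from the starting vertices contain every `next` edge as a step, so running against
    -- `next` means running against a path of the family.
    have hback : ∀ d ∈ γ.darts, L.next d.snd ≠ some d.fst := by
      intro d hd hn
      obtain ⟨t, ht, htv⟩ := L.exists_start d.snd
      exact hcon _ ⟨t, ht, rfl⟩ d hd (hstep t _ ((hmem _ _).2 htv) _ hn)
    have hle : ∀ d ∈ γ.darts, L.time d.fst ≤ L.time d.snd := by
      intro d hd
      obtain ⟨-, e, he⟩ := d.adj
      obtain ⟨x, y, hxy, H⟩ := L.ends_eq e
      rcases Sym2.eq_iff.1 (he.symm.trans hxy) with ⟨h₁, h₂⟩ | ⟨h₁, h₂⟩ <;>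
        rw [h₁, h₂] <;> rcases H with H | ⟨-, -, -, -, H⟩ | ⟨H, -⟩
      · exact (L.time_lt _ _ H).le
      · exact H.le
      · simp [hL] at H
      · exact (hback d hd (by rw [h₁, h₂, H])).elim
      · exact H.ge
      · simp [hL] at H
    rcases hds with h | h
    · exact lt_irrefl _ ((L.time_le_of_walk γ hle).2 d hd (L.time_lt _ _ (hpath _ _ _ h)))
    · exact hback d hd (hpath _ _ _ h)

theorem exists_equivalent_circuitLike (L : D.Layout) :
    ∃ D' : Diagram m n, D.Equivalent D' ∧ D'.CircuitLike := by
  obtain ⟨D₁, h₁, L₁, hL₁⟩ := exists_equivalent_pending_eq_empty _ D L rfl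
  obtain ⟨D₂, h₂, hc, L₂, hL₂⟩ := exists_equivalent_isThreeColoured _ D₁ L₁ hL₁ rfl
  exact ⟨D₂, .trans _ _ _ h₁ h₂, L₂.circuitLike hL₂ hc⟩

end Layout

end Diagram

end ZX

/-! ### From a flow to a layout -/

namespace ZX.OpenGraph

variable {V : Type}

/-- Extend the partial order to a linear one and enumerate it. -/
theorem exists_numbering [Finite V] (o : PartialOrder V) :
    ∃ (N : ℕ) (τ : V → ℕ), Function.Injective τ ∧ (∀ v, τ v < N) ∧ ∀ u v, o.lt u v → τ u < τ v := by
  have : Fintype (LinearExtension V) := @Fintype.ofFinite (LinearExtension V) ‹_›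
  let g := (monoEquivOfFin (LinearExtension V) rfl).symm
  have hinj : Function.Injective fun v : V => (g (toLinearExtension v) : ℕ) :=
    fun u v h => g.injective (Fin.ext h)
  refine ⟨_, fun v => g (toLinearExtension v), hinj, fun v => (g _).2, fun u v h => ?_⟩
  refine lt_of_le_of_ne (g.monotone (toLinearExtension.monotone h.le)) fun h' => ?_
  exact h.ne (hinj h')

variable {Γ : OpenGraph V}

namespace Flow

/-- If distinct `u` and `v` had the same image, that image would be adjacent to both, so each of
them would precede the other. -/
theorem f_injective (F : Γ.Flow) : Function.Injective F.f := by
  intro u v h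
  by_contra hne
  let _ := F.order
  exact lt_asymm (F.lt_of_adj u v (h ▸ F.adj v) fun h => hne (Subtype.ext h))
    (F.lt_of_adj v u (h ▸ F.adj u) fun h => hne (Subtype.ext h).symm)

/-- The edge from `u` to `f u`. -/
def edge (F : Γ.Flow) (u : {v // v ∉ Γ.outputs}) : Γ.graph.edgeSet :=
  ⟨s(u, F.f u), (F.adj u).symm⟩

/-- Otherwise `f u = v` and `f v = u`, so that `u` and `v` precede each other. -/
theorem edge_injective (F : Γ.Flow) : Function.Injective F.edge := by
  intro u v h
  rcases Sym2.eq_iff.1 (congrArg Subtype.val h) with ⟨h, -⟩ | ⟨h₁, h₂⟩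
  · exact Subtype.ext h
  · let _ := F.order
    have hu := F.lt_f u
    have hv := F.lt_f v
    rw [h₂] at hu
    rw [← h₁] at hv
    exact (lt_asymm hu hv).elim

open Classical in
/-- The successors along the paths of a flow. -/
noncomputable def next (F : Γ.Flow) : Γ.DVertex → Option Γ.DVertex
  | .ofI i => some (.ofV i)
  | .ofV v => if h : v ∈ Γ.outputs then some (.ofO ⟨v, h⟩) else some (.ofE (F.edge ⟨v, h⟩))
  | .ofE e => if h : ∃ u, F.edge u = e then some (.ofV (F.f h.choose)) else none
  | .ofO _ => none

theorem next_ofV (F : Γ.Flow) (u : {v // v ∉ Γ.outputs}) : F.next (.ofV u) = some (.ofE (F.edge u)) :=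
  dif_neg u.2

theorem next_ofV_output (F : Γ.Flow) (o : Γ.outputs) : F.next (.ofV o) = some (.ofO o) :=
  dif_pos o.2

theorem next_edge (F : Γ.Flow) (u : {v // v ∉ Γ.outputs}) :
    F.next (.ofE (F.edge u)) = some (.ofV (F.f u)) := by
  have h : ∃ u', F.edge u' = F.edge u := ⟨u, rfl⟩
  rw [next, dif_pos h, F.edge_injective h.choose_spec]

theorem next_ofE (F : Γ.Flow) {e : Γ.graph.edgeSet} (h : ∀ u, F.edge u ≠ e) :
    F.next (.ofE e) = none :=
  dif_neg (not_exists.2 h)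

theorem next_cases (F : Γ.Flow) {a b : Γ.DVertex} (h : F.next a = some b) :
    (∃ i : Γ.inputs, a = .ofI i ∧ b = .ofV i) ∨ (∃ o : Γ.outputs, a = .ofV o ∧ b = .ofO o) ∨
    (∃ u : {v // v ∉ Γ.outputs}, a = .ofV u ∧ b = .ofE (F.edge u)) ∨
    ∃ u, a = .ofE (F.edge u) ∧ b = .ofV (F.f u) := by
  rcases a with v | e | i | o
  · by_cases hv : v ∈ Γ.outputs
    · rw [F.next_ofV_output ⟨v, hv⟩, Option.some_inj] at h
      exact .inr (.inl ⟨⟨v, hv⟩, rfl, h.symm⟩)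
    · rw [F.next_ofV ⟨v, hv⟩, Option.some_inj] at h
      exact .inr (.inr (.inl ⟨⟨v, hv⟩, rfl, h.symm⟩))
  · by_cases he : ∃ u, F.edge u = e
    · obtain ⟨u, rfl⟩ := he
      rw [F.next_edge, Option.some_inj] at h
      exact .inr (.inr (.inr ⟨u, rfl, h.symm⟩))
    · simp [F.next_ofE (not_exists.1 he)] at h
  · exact .inl ⟨i, rfl, (Option.some_inj.1 h).symm⟩
  · cases h

open Classical in
/-- The time at which a qubit is created. -/
noncomputable def birth (F : Γ.Flow) (N : ℕ) (τ : V → ℕ) (v : V) : ℝ :=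
  -- Time is divided into blocks of length `N`, the block of `u` starting at `N * τ u`. The qubit `f
  -- u` is born `1/4` before the end of the block of `u`, just after the Hadamard vertex that leads
  -- to it. Qubits outside the range of `f` are born before all blocks, but after the input
  -- vertices.
  if h : ∃ u, (F.f u : V) = v then N * (τ h.choose + 1) - 1 / 4 else - 1 / 4

theorem birth_f (F : Γ.Flow) (N : ℕ) (τ : V → ℕ) (u : {v // v ∉ Γ.outputs}) :
    F.birth N τ (F.f u) = N * (τ u + 1) - 1 / 4 := by
  have h : ∃ u', (F.f u' : V) = F.f u := ⟨u, rfl⟩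
  rw [birth, dif_pos h, F.f_injective (Subtype.ext h.choose_spec)]

theorem birth_of_ne (F : Γ.Flow) (N : ℕ) (τ : V → ℕ) {v : V} (h : ∀ u, (F.f u : V) ≠ v) :
    F.birth N τ v = - 1 / 4 :=
  dif_neg (not_exists.2 h)

open Classical in
/-- The times of the vertices of the diagram of an open graph. -/
noncomputable def time (F : Γ.Flow) (N : ℕ) (τ : V → ℕ) : Γ.DVertex → ℝ
  | .ofI _ => - 1 / 2
  | .ofV v => F.birth N τ v
  | .ofE e =>
    -- Any other edge gets the two-digit number in base `N` formed by the smaller and the larger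
    -- number of its ends. It lies in the block of the smaller end and determines the edge.
    if h : ∃ u, F.edge u = e then N * τ h.choose + N - 1 / 2
    else ((N * (e.1.map τ).inf + (e.1.map τ).sup : ℕ) : ℝ)
  | .ofO o => N * τ o + N

theorem time_edge (F : Γ.Flow) (N : ℕ) (τ : V → ℕ) (u : {v // v ∉ Γ.outputs}) :
    F.time N τ (.ofE (F.edge u)) = N * τ u + N - 1 / 2 := by
  have h : ∃ u', F.edge u' = F.edge u := ⟨u, rfl⟩
  rw [time, dif_pos h, F.edge_injective h.choose_spec]

theorem time_ofE (F : Γ.Flow) (N : ℕ) (τ : V → ℕ) {e : Γ.graph.edgeSet} (h : ∀ u, F.edge u ≠ e) :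
    F.time N τ (.ofE e) = ((N * (e.1.map τ).inf + (e.1.map τ).sup : ℕ) : ℝ) :=
  dif_neg (not_exists.2 h)

/-- A numbering of the vertices by numbers less than `N` that is compatible with the flow. -/
structure Numbering (F : Γ.Flow) (N : ℕ) (τ : V → ℕ) : Prop where
  injective : Function.Injective τ
  lt : ∀ v, τ v < N
  mono : ∀ u v, F.order.lt u v → τ u < τ v

/-! ### Inequalities between the times -/

namespace Numbering

variable {F : Γ.Flow} {N : ℕ} {τ : V → ℕ}

/-- If `v = f u`, then `u` precedes `v`, so the block of `u` is over when that of `v` starts. -/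
theorem birth_le (H : F.Numbering N τ) (v : V) : F.birth N τ v ≤ N * τ v - 1 / 4 := by
  by_cases h : ∃ u, (F.f u : V) = v
  · obtain ⟨u, rfl⟩ := h
    rw [F.birth_f]
    have : (τ u + 1 : ℝ) ≤ τ (F.f u) := by exact_mod_cast H.mono _ _ (F.lt_f u)
    gcongr
  · rw [F.birth_of_ne _ _ (not_exists.1 h)]
    have : (0 : ℝ) ≤ N * τ v := by positivity
    linarith

theorem pos (H : F.Numbering N τ) (v : V) : (1 : ℝ) ≤ N := by
  exact_mod_cast (Nat.zero_le _).trans_lt (H.lt v)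

/-- This uses the last flow axiom. If `a = f u`, then `b` is not `u`, because the edge is not a flow
edge; hence `u` precedes `b` as well as `a`. So the smaller number of the two ends is at least `τ u
+ 1`, and the edge comes after the block of `u`. -/
theorem birth_lt_time (H : F.Numbering N τ) {a b : V} (he : s(a, b) ∈ Γ.graph.edgeSet)
    (h : ∀ u, F.edge u ≠ ⟨s(a, b), he⟩) : F.birth N τ a < F.time N τ (.ofE ⟨s(a, b), he⟩) := by
  rw [F.time_ofE N τ h]
  by_cases ha : ∃ u, (F.f u : V) = a
  · obtain ⟨u, rfl⟩ := ha
    have hub : (u : V) ≠ b := by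
      rintro rfl
      exact h u (Subtype.ext Sym2.eq_swap)
    have h₁ := H.mono _ _ (F.lt_f u)
    have h₂ := H.mono _ _ (F.lt_of_adj u b he hub)
    rw [F.birth_f]
    have h₃ : N * (τ u + 1) ≤ N * ((s((F.f u : V), b)).map τ).inf + ((s((F.f u : V), b)).map τ).sup := by
      refine le_add_right (Nat.mul_le_mul_left _ ?_)
      simp only [Sym2.map_mk, Sym2.inf_mk]
      exact le_inf h₁ h₂
    have h₄ := Nat.cast_le (α := ℝ).2 h₃
    push_cast at h₄ ⊢
    linarith
  · rw [F.birth_of_ne _ _ (not_exists.1 ha)]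
    have : (0 : ℝ) ≤ ((N * ((s(a, b)).map τ).inf + ((s(a, b)).map τ).sup : ℕ) : ℝ) := Nat.cast_nonneg _
    linarith

/-- The smaller number is at most `τ a` and the larger one at most `N - 1`. The bound stays below
both possible successors of `a`: a flow edge at `N * τ a + N - 1 / 2`, or an output at `N * τ a +
N`. -/
theorem time_le (H : F.Numbering N τ) {a b : V} (he : s(a, b) ∈ Γ.graph.edgeSet)
    (h : ∀ u, F.edge u ≠ ⟨s(a, b), he⟩) : F.time N τ (.ofE ⟨s(a, b), he⟩) ≤ N * τ a + N - 1 := by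
  rw [F.time_ofE N τ h]
  have h₁ : N * ((s(a, b)).map τ).inf + ((s(a, b)).map τ).sup + 1 ≤ N * τ a + N := by
    rw [add_assoc]
    simp only [Sym2.map_mk, Sym2.inf_mk, Sym2.sup_mk]
    exact add_le_add (Nat.mul_le_mul_left _ inf_le_left) (Nat.succ_le_of_lt (sup_lt_iff.2 ⟨H.lt a, H.lt b⟩))
  have h₂ := Nat.cast_le (α := ℝ).2 h₁
  push_cast at h₂ ⊢
  linarith

/-- Quotient and remainder modulo `N` recover the minimum and maximum of the two numbers, hence the
unordered pair. -/
theorem time_injOn (H : F.Numbering N τ) {e e' : Γ.graph.edgeSet} (he : ∀ u, F.edge u ≠ e)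
    (he' : ∀ u, F.edge u ≠ e') (h : F.time N τ (.ofE e) = F.time N τ (.ofE e')) : e = e' := by
  rw [F.time_ofE N τ he, F.time_ofE N τ he', Nat.cast_inj] at h
  have hsup : ∀ s : Sym2 V, (s.map τ).sup < N := by
    rintro ⟨a, b⟩
    exact sup_lt_iff.2 ⟨H.lt a, H.lt b⟩
  have h₁ := congrArg (· % N) h
  have h₂ := congrArg (· / N) h
  have hN : 0 < N := (Nat.zero_le _).trans_lt (hsup e)
  simp only [Nat.mul_add_mod, Nat.mod_eq_of_lt (hsup _)] at h₁
  simp only [Nat.mul_add_div hN, Nat.div_eq_of_lt (hsup _), add_zero] at h₂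
  exact Subtype.ext (Sym2.map.injective H.injective (Sym2.inf_eq_inf_and_sup_eq_sup.1 ⟨h₂, h₁⟩))

end Numbering

end Flow

theorem toDiagram_isSimple [Finite V] [LinearOrder V] (Γ : OpenGraph V) : Γ.toDiagram.IsSimple := by
  have hinj : ∀ e e', Γ.dEnds e = Γ.dEnds e' → e = e' := by
    rintro (⟨e, u⟩ | i | o) (⟨e', u'⟩ | i' | o') h <;> simp [dEnds] at h
    · obtain ⟨h, rfl⟩ := h
      rw [Subtype.ext h]
    · rw [h]
    · rw [h]
  refine ⟨hinj, ?_⟩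
  · intro e h
    obtain ⟨⟨a, b⟩, hab⟩ := Quot.exists_rep (Γ.toDiagram.ends e)
    rw [← hab] at h
    obtain rfl : a = b := h
    exact Set.eq_empty_iff_forall_notMem.1 (Γ.dEnds_ne_loop a) e hab.symm

/-- The layout of the diagram of an open graph that is given by a flow. -/
noncomputable def Flow.layout [Finite V] [LinearOrder V] (F : Γ.Flow) {N : ℕ} {τ : V → ℕ}
    (H : F.Numbering N τ) : Γ.toDiagram.Layout where
  pending := {a | ∃ e, (∀ u, F.edge u ≠ e) ∧ a = .ofE e}
  next := F.next
  time := F.time N τ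
  simple := Γ.toDiagram_isSimple
  kind_of_mem := by
    rintro _ ⟨e, -, rfl⟩
    rfl
  next_of_mem := by
    rintro _ ⟨e, he, rfl⟩
    exact F.next_ofE he
  next_notMem := by
    rintro a _ h ⟨e, he, rfl⟩
    rcases F.next_cases h with ⟨i, -, h⟩ | ⟨o, -, h⟩ | ⟨u, -, h⟩ | ⟨u, -, h⟩ <;> cases h
    exact he u rfl
  exists_edge := by
    intro a b h
    rcases F.next_cases h with ⟨i, rfl, rfl⟩ | ⟨o, rfl, rfl⟩ | ⟨u, rfl, rfl⟩ | ⟨u, rfl, rfl⟩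
    · exact ⟨.inp i, rfl⟩
    · exact ⟨.out o, Sym2.eq_swap⟩
    · exact ⟨.inc (F.edge u) ⟨u, Sym2.mem_mk_left _ _⟩, rfl⟩
    · exact ⟨.inc (F.edge u) ⟨F.f u, Sym2.mem_mk_right _ _⟩, Sym2.eq_swap⟩
  next_injective := by
    intro a b c ha hb
    rcases F.next_cases ha with ⟨i, rfl, rfl⟩ | ⟨o, rfl, rfl⟩ | ⟨u, rfl, rfl⟩ | ⟨u, rfl, rfl⟩ <;>
    rcases F.next_cases hb with ⟨i', rfl, h⟩ | ⟨o', rfl, h⟩ | ⟨u', rfl, h⟩ | ⟨u', rfl, h⟩ <;>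
    simp only [DVertex.ofV.injEq, DVertex.ofE.injEq, DVertex.ofO.injEq, reduceCtorEq] at h
    · rw [Subtype.ext h]
    · exact ((F.f u').2 (h ▸ i.2)).elim
    · rw [h]
    · rw [F.edge_injective h]
    · exact ((F.f u).2 (h ▸ i'.2)).elim
    · rw [F.f_injective (Subtype.ext h)]
  exists_output := by
    rintro (v | e | i | o) ha h
    · by_cases hv : v ∈ Γ.outputs
      · simp [F.next_ofV_output ⟨v, hv⟩] at h
      · simp [F.next_ofV ⟨v, hv⟩] at h
    · refine (ha ⟨e, fun u hu => ?_, rfl⟩).elim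
      subst hu
      simp [F.next_edge] at h
    · cases h
    · exact ⟨_, rfl⟩
  time_lt := by
    intro a b h
    rcases F.next_cases h with ⟨i, rfl, rfl⟩ | ⟨o, rfl, rfl⟩ | ⟨u, rfl, rfl⟩ | ⟨u, rfl, rfl⟩
    · change -1 / 2 < F.birth N τ i
      -- An input qubit is not a value of `f`, so it is born at `-1/4`, after its input vertex at
      -- `-1/2`.
      rw [F.birth_of_ne]
      · norm_num
      · exact fun u hu => (F.f u).2 (hu ▸ i.2)
    · have h₁ := H.birth_le o
      have h₂ := H.pos o
      change F.birth N τ o < N * τ o + N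
      linarith
    · have h₁ := H.birth_le u
      have h₂ := H.pos u
      rw [F.time_edge]
      change F.birth N τ u < _
      linarith
    · rw [F.time_edge]
      change _ < F.birth N τ (F.f u)
      rw [F.birth_f]
      linarith
  ends_eq := by
    rintro (⟨e, u⟩ | i | o)
    · by_cases he : ∃ u, F.edge u = e
      · obtain ⟨v, rfl⟩ := he
        obtain ⟨u, hu⟩ := u
        rcases Sym2.mem_iff.1 hu with rfl | rfl
        · exact ⟨_, _, rfl, .inl (F.next_ofV v)⟩
        · exact ⟨_, _, Sym2.eq_swap, .inl (F.next_edge v)⟩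
      · have he' := not_exists.1 he
        -- Every edge off the wires ends in a pending vertex here; edges between spiders of equal
        -- time appear only through `Site.pullOut`.
        refine ⟨_, _, rfl, .inr (.inr ⟨⟨e, he', rfl⟩, ⟨0, rfl⟩, ?_⟩)⟩
        obtain ⟨e, hΓ⟩ := e
        obtain ⟨u, hu⟩ := u
        obtain ⟨b, hb⟩ : ∃ b, e = s(u, b) := hu
        subst hb
        refine ⟨H.birth_lt_time hΓ he', fun z hz => ?_⟩
        have h₁ := H.time_le hΓ he'
        rcases F.next_cases hz with ⟨i, h, rfl⟩ | ⟨o, h, rfl⟩ | ⟨v, h, rfl⟩ | ⟨v, h, rfl⟩ <;>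
          simp only [DVertex.ofV.injEq, reduceCtorEq] at h <;> subst h
        · change _ < (N * τ o + N : ℝ)
          linarith
        · rw [F.time_edge]
          linarith
    · exact ⟨.ofI i, .ofV i, rfl, .inl rfl⟩
    · exact ⟨.ofV o, .ofO o, Sym2.eq_swap, .inl (F.next_ofV_output o)⟩
  injOn_time := by
    rintro _ ⟨e, he, rfl⟩ _ ⟨e', he', rfl⟩ h
    rw [H.time_injOn he he' h]

/-- The diagram of an open graph with flow is equivalent to a circuit-like diagram. -/
theorem HasFlow.exists_equivalent_circuitLike [Finite V] [LinearOrder V] (h : Γ.HasFlow) :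
    ∃ D : Diagram Γ.inputs.card Γ.outputs.card, Γ.toDiagram.Equivalent D ∧ D.CircuitLike := by
  obtain ⟨F⟩ := h
  obtain ⟨N, τ, h₁, h₂, h₃⟩ := exists_numbering F.order
  exact (F.layout ⟨h₁, h₂, h₃⟩).exists_equivalent_circuitLike

end ZX.OpenGraph

theorem mainTheorem1 {Q : Type} [Fintype Q] [LinearOrder Q] (P : ZX.Pattern Q)
    (hflow : P.geometry.HasFlow) :
    ∃ D : ZX.Diagram P.geometry.inputs.card P.geometry.outputs.card,
      P.geometry.toDiagram.Equivalent D ∧ D.CircuitLike :=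
  hflow.exists_equivalent_circuitLike
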